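/- Let $\widetilde{\mathrm{SL}}_2(\mathbb{R})=\mathrm{SL}_2(\mathbb{R})\times\{\pm1\}$ be the metaplectic group with multiplication $(g_1,\epsilon_1)(g_2,\epsilon_2)=(g_1g_2,\alpha(g_1,g_2)\epsilon_1\epsilon_2)$, where $\alpha(g_1,g_2)=\left(\frac{X(g_1g_2)}{X(g_1)},\frac{X(g_1g_2)}{X(g_2)}\right)_H$, $(\cdot,\cdot)_H$ is the real Hilbert symbol, and $X\begin{pmatrix}a&b\\c&d\end{pmatrix}$ is $c$ if $c\neq0$ and $d$ if $c=0$; give it the smooth structure for which it is a Lie group and a smooth covering of $\mathrm{SL}_2(\mathbb{R})$. Put $\tilde m_{\epsilon_1,\epsilon_2}=(\epsilon_1 1,\epsilon_2)$, $\tilde a_u=(\mathrm{diag}(u,u^{-1}),1)$ for $u>0$, $\tilde n_x=\left(\begin{pmatrix}1&x\\0&1\end{pmatrix},1\right)$, $\tilde n_{-,x}=\left(\begin{pmatrix}1&0\\x&1\end{pmatrix},1\right)$, and $\tilde k_\theta=\left(\begin{pmatrix}\cos\theta&-\sin\theta\\\sin\theta&\cos\theta\end{pmatrix},\varepsilon(\theta)\right)$,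 where $\varepsilon$ has period $4\pi$, is $1$ on $[-\pi,\pi)$ and $-1$ on $[-2\pi,-\pi)\cup[\pi,2\pi)$; put $\tilde s=\tilde k_{\pi/2}$, $\tilde K=\{\tilde k_\theta\}$ and $\tilde B=\{\tilde m_{\epsilon_1,\epsilon_2}\tilde a_u\tilde n_{-,x}\}$. For $\epsilon\in\{\pm1\}$ and $\nu\in\mathbb{C}$ let $\omega_{\epsilon,\nu}$ be the quasi-character $\tilde m\,\tilde a_u\,\tilde n_{-,x}\mapsto\sigma_\epsilon(\tilde m)u^{\nu-1}$ of $\tilde B$, where $\sigma_\epsilon(\tilde m_{1,\pm1})=\pm1$ and $\sigma_\epsilon(\tilde m_{-1,\pm1})=\mp\epsilon i$, and let $V^\infty_{\epsilon,\nu}$ be the space of smooth $f:\widetilde{\mathrm{SL}}_2(\mathbb{R})\to\mathbb{C}$ with $f(\tilde g\tilde b)=\omega_{\epsilon,\nu}(\tilde b^{-1})f(\tilde g)$ for all $\tilde g$ and all $\tilde b\in\tilde B$. Let $I_{\epsilon,\nu}:V^\infty_{\epsilon,-\nu}\to V^\infty_{\epsilon,\nu}$ be the intertwining operator, given for $\mathrm{Re}\,\nu>0$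 by the absolutely convergent integral $$I_{\epsilon,\nu}f(\tilde g)=\int_{-\infty}^{\infty}f(\tilde g\,\tilde s\,\tilde n_t)\,dt,$$ and for other $\nu$ by meromorphic continuation in $\nu$, with $f|_{\tilde K}$ held fixed. (a) For every $\nu\in\mathbb{C}$ and every $\ell\in2\mathbb{Z}$ there is a unique $\phi_{\epsilon,\nu,\ell}\in V^\infty_{\epsilon,\nu}$ such that $\phi_{\epsilon,\nu,\ell}(\tilde k_\theta)=\exp\left(-\epsilon\left(\tfrac12+\ell\right)i\theta\right)$ for all $\theta$. (b) For every $\ell\in2\mathbb{Z}$ and every $\nu\in\mathbb{C}\setminus\mathbb{Z}_{\le0}$, $I_{\epsilon,\nu}$ is defined on $\phi_{\epsilon,-\nu,\ell}$ (the continuation has no pole at $\nu$), and $$I_{\epsilon,\nu}\phi_{\epsilon,-\nu,\ell}=i^{-\epsilon\ell}\,\frac{1-\epsilon i}{\sqrt2}\cdot\frac{\pi\,2^{1-\nu}\,\Gamma(\nu)}{\Gamma\left(-\frac12\left(\ell+\frac12\right)+\frac{\nu+1}2\right)\Gamma\left(\frac12\left(\ell+\frac12\right)+\frac{\nu+1}2\right)}\,\phi_{\epsilon,\nu,\ell},$$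 where $1/\Gamma$ is read as $0$ at the poles of $\Gamma$. (c) For every $\nu\in\mathbb{C}\setminus\mathbb{Z}$ and every $f\in V^\infty_{\epsilon,-\nu}$, $I_{\epsilon,\nu}$ is defined on $f$, $I_{\epsilon,\nu}f\in V^\infty_{\epsilon,\nu}$, $I_{\epsilon,-\nu}$ is defined on $I_{\epsilon,\nu}f$, and $$I_{\epsilon,-\nu}I_{\epsilon,\nu}f=\frac{2\pi\epsilon i\cot(\pi\nu)}{\nu}\,f.$$ -/

import Mathlib

open MeasureTheory Set
open scoped MatrixGroups ContDiff Manifold UpperHalfPlane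

noncomputable section

namespace Metaplectic

/-- The Hilbert symbol of `ℝ`. -/
def hilbertSymbol (x y : ℝ) : ℤˣ := if x < 0 ∧ y < 0 then -1 else 1

/-- `X (a b; c d)` is `c` if `c ≠ 0` and `d` if `c = 0`. -/
def kubotaX (g : SL(2, ℝ)) : ℝ := if g 1 0 ≠ 0 then g 1 0 else g 1 1

/-- The Kubota cocycle `α`. -/
def cocycle (g₁ g₂ : SL(2, ℝ)) : ℤˣ :=
  hilbertSymbol (kubotaX (g₁ * g₂) / kubotaX g₁) (kubotaX (g₁ * g₂) / kubotaX g₂)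

/-! ### The cocycle identity

It is proved with the arguments of the automorphy factors `c z + d`. -/

/-- The argument of a complex number, normalised to lie in `[-π, π)`. -/
def argL (w : ℂ) : ℝ := if Complex.arg w = Real.pi then -Real.pi else Complex.arg w

theorem argL_mem (w : ℂ) : -Real.pi ≤ argL w ∧ argL w < Real.pi := by
  unfold argL
  have h1 := Complex.neg_pi_lt_arg w
  have h2 := Complex.arg_le_pi w
  have h3 := Real.pi_pos
  split_ifs with h
  · constructor <;> linarith
  · exact ⟨h1.le, lt_of_le_of_ne h2 h⟩

theorem argL_coe (w : ℂ) : (argL w : Real.Angle) = (Complex.arg w : Real.Angle) := by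
  unfold argL
  split_ifs with h
  · rw [h]; simp
  · rfl

theorem kubotaX_ne_zero (g : SL(2, ℝ)) : kubotaX g ≠ 0 := by
  unfold kubotaX
  split_ifs with h
  · exact h
  · intro h'
    have := g.det_coe
    rw [Matrix.det_fin_two] at this
    push Not at h
    simp_all

/-- The automorphy factor `c z + d`. -/
def autFactor (g : SL(2, ℝ)) (z : ℍ) : ℂ := (g 1 0 : ℂ) * z + (g 1 1 : ℂ)

theorem argL_autFactor (g : SL(2, ℝ)) (z : ℍ) :
    (0 < kubotaX g ↔ 0 ≤ argL (autFactor g z)) := by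
  have hX := kubotaX_ne_zero g
  have hz := z.im_pos
  have hpi := Real.pi_pos
  have him : (autFactor g z).im = g 1 0 * z.im := by simp [autFactor]
  have hre : g 1 0 = 0 → autFactor g z = ((g 1 1 : ℝ) : ℂ) := by
    intro h; simp [autFactor, h]
  by_cases hc : g 1 0 = 0
  · have hk : kubotaX g = g 1 1 := by simp [kubotaX, hc]
    rw [hk] at hX ⊢
    rw [hre hc]
    rcases lt_or_gt_of_ne hX with h | h
    · have : Complex.arg ((g 1 1 : ℝ) : ℂ) = Real.pi := Complex.arg_ofReal_of_neg h
      simp only [argL, this, if_true]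
      constructor <;> intro <;> linarith
    · have : Complex.arg ((g 1 1 : ℝ) : ℂ) = 0 := Complex.arg_ofReal_of_nonneg h.le
      simp only [argL, this, if_neg hpi.ne]
      exact ⟨fun _ => le_refl _, fun _ => h⟩
  · have hk : kubotaX g = g 1 0 := by simp [kubotaX, hc]
    rw [hk]
    have hne : Complex.arg (autFactor g z) ≠ Real.pi := by
      intro h
      have := (Complex.arg_eq_pi_iff.1 h).2
      rw [him] at this
      rcases mul_eq_zero.1 this with h | h
      · exact hc h
      · exact hz.ne' h
    simp only [argL, if_neg hne]
    rw [Complex.arg_nonneg_iff, him]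
    constructor
    · intro h; positivity
    · intro h
      rcases lt_or_gt_of_ne hc with h' | h'
      · nlinarith
      · exact h'

theorem autFactor_ne_zero (g : SL(2, ℝ)) (z : ℍ) : autFactor g z ≠ 0 := by
  have := UpperHalfPlane.denom_ne_zero (g : GL (Fin 2) ℝ) z
  simpa [UpperHalfPlane.denom, autFactor] using this

theorem autFactor_mul (g h : SL(2, ℝ)) (z : ℍ) :
    autFactor (g * h) z = autFactor g (h • z) * autFactor h z := by
  have h0 := autFactor_ne_zero h z
  have h1 : ((h • z : ℍ) : ℂ) = ((h 0 0 : ℂ) * z + (h 0 1 : ℂ)) / autFactor h z := by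
    rw [UpperHalfPlane.specialLinearGroup_apply]; simp [autFactor]
  have h2 : autFactor g (h • z) = (g 1 0 : ℂ) * ((h • z : ℍ) : ℂ) + (g 1 1 : ℂ) := rfl
  rw [h2, h1, add_mul, mul_assoc, div_mul_cancel₀ _ h0]
  simp only [autFactor, Matrix.SpecialLinearGroup.coe_mul, Matrix.mul_apply, Fin.sum_univ_two]
  push_cast
  ring

/-- The integer-valued refinement of the cocycle. -/
def cocycleZ (g₁ g₂ : SL(2, ℝ)) : ℤ :=
  if 0 < kubotaX g₁ ∧ 0 < kubotaX g₂ ∧ kubotaX (g₁ * g₂) < 0 then 1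
  else if kubotaX g₁ < 0 ∧ kubotaX g₂ < 0 ∧ 0 < kubotaX (g₁ * g₂) then -1 else 0

theorem argL_mul (g h : SL(2, ℝ)) (z : ℍ) :
    argL (autFactor g (h • z)) + argL (autFactor h z) =
      argL (autFactor (g * h) z) + 2 * Real.pi * cocycleZ g h := by
  have e : ((argL (autFactor g (h • z)) + argL (autFactor h z) : ℝ) : Real.Angle) =
      (argL (autFactor (g * h) z) : Real.Angle) := by
    rw [Real.Angle.coe_add, argL_coe, argL_coe, argL_coe, autFactor_mul,
      Complex.arg_mul_coe_angle (autFactor_ne_zero _ _) (autFactor_ne_zero _ _)]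
  obtain ⟨k, hk⟩ := Real.Angle.angle_eq_iff_two_pi_dvd_sub.1 e
  have a1 := argL_mem (autFactor g (h • z))
  have a2 := argL_mem (autFactor h z)
  have a3 := argL_mem (autFactor (g * h) z)
  have s1 := argL_autFactor g (h • z)
  have s2 := argL_autFactor h z
  have s3 := argL_autFactor (g * h) z
  have n1 := kubotaX_ne_zero g
  have n2 := kubotaX_ne_zero h
  have n3 := kubotaX_ne_zero (g * h)
  have hpi := Real.pi_pos
  have key : k = cocycleZ g h := by
    have kb1 : k < 2 := by
      by_contra hc
      have : (2 : ℝ) ≤ k := by exact_mod_cast not_lt.1 hc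
      nlinarith
    have kb2 : -2 < k := by
      by_contra hc
      have : (k : ℝ) ≤ -2 := by exact_mod_cast not_lt.1 hc
      nlinarith
    unfold cocycleZ
    rcases lt_or_gt_of_ne n1 with m1 | m1 <;> rcases lt_or_gt_of_ne n2 with m2 | m2 <;>
      rcases lt_or_gt_of_ne n3 with m3 | m3 <;>
      simp only [m1, m2, m3, m1.not_gt, m2.not_gt, m3.not_gt, and_false,
        and_true, if_true, if_false, true_iff, false_iff, not_le] at s1 s2 s3 ⊢ <;>
      interval_cases k <;> first | rfl | (exfalso; push_cast at hk; linarith)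
  rw [← key]; linarith

theorem cocycle_eq (g₁ g₂ : SL(2, ℝ)) : cocycle g₁ g₂ = (-1) ^ (cocycleZ g₁ g₂) := by
  have n1 := kubotaX_ne_zero g₁
  have n2 := kubotaX_ne_zero g₂
  have n3 := kubotaX_ne_zero (g₁ * g₂)
  unfold cocycle hilbertSymbol cocycleZ
  simp only [div_neg_iff]
  rcases lt_or_gt_of_ne n1 with m1 | m1 <;> rcases lt_or_gt_of_ne n2 with m2 | m2 <;>
    rcases lt_or_gt_of_ne n3 with m3 | m3 <;>
    simp [m1, m2, m3, m1.not_gt, m2.not_gt, m3.not_gt]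

theorem cocycle_assoc (g₁ g₂ g₃ : SL(2, ℝ)) :
    cocycle g₁ g₂ * cocycle (g₁ * g₂) g₃ = cocycle g₁ (g₂ * g₃) * cocycle g₂ g₃ := by
  have e1 := argL_mul g₁ g₂ (g₃ • UpperHalfPlane.I)
  have e2 := argL_mul (g₁ * g₂) g₃ UpperHalfPlane.I
  have e3 := argL_mul g₁ (g₂ * g₃) UpperHalfPlane.I
  have e4 := argL_mul g₂ g₃ UpperHalfPlane.I
  rw [mul_smul] at e3
  rw [mul_assoc] at e2
  have e : (2 * Real.pi) * ((cocycleZ g₁ g₂ + cocycleZ (g₁ * g₂) g₃ : ℤ) : ℝ) =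
      (2 * Real.pi) * ((cocycleZ g₁ (g₂ * g₃) + cocycleZ g₂ g₃ : ℤ) : ℝ) := by
    push_cast; linarith
  have e' := mul_left_cancel₀ (by positivity) e
  simp only [cocycle_eq, ← zpow_add]
  congr 1
  exact_mod_cast e'

/-! ### The metaplectic group -/

/-- The underlying set `SL₂(ℝ) × {±1}` of the metaplectic group. -/
@[ext]
structure Mp where
  mat : SL(2, ℝ)
  sgn : ℤˣ

namespace Mp

instance : Mul Mp := ⟨fun x y => ⟨x.mat * y.mat, cocycle x.mat y.mat * x.sgn * y.sgn⟩⟩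
instance : One Mp := ⟨⟨1, 1⟩⟩
instance : Inv Mp := ⟨fun x => ⟨x.mat⁻¹, cocycle x.mat⁻¹ x.mat * x.sgn⟩⟩

@[simp] theorem mul_mat (x y : Mp) : (x * y).mat = x.mat * y.mat := rfl
@[simp] theorem mul_sgn (x y : Mp) : (x * y).sgn = cocycle x.mat y.mat * x.sgn * y.sgn := rfl
@[simp] theorem one_mat : (1 : Mp).mat = 1 := rfl
@[simp] theorem one_sgn : (1 : Mp).sgn = 1 := rfl
@[simp] theorem inv_mat (x : Mp) : (x⁻¹).mat = x.mat⁻¹ := rfl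
@[simp] theorem inv_sgn (x : Mp) : (x⁻¹).sgn = cocycle x.mat⁻¹ x.mat * x.sgn := rfl

theorem cocycle_one_left (g : SL(2, ℝ)) : cocycle 1 g = 1 := by
  have h := kubotaX_ne_zero g
  simp only [cocycle, hilbertSymbol, one_mul, div_self h]
  rw [if_neg]
  rintro ⟨-, h⟩
  linarith

instance : Group Mp := Group.ofLeftAxioms
  (fun x y z => by
    ext1
    · simp [mul_assoc]
    · have h := cocycle_assoc x.mat y.mat z.mat
      simp only [mul_sgn, mul_mat]
      calc cocycle (x.mat * y.mat) z.mat * (cocycle x.mat y.mat * x.sgn * y.sgn) * z.sgn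
          = (cocycle x.mat y.mat * cocycle (x.mat * y.mat) z.mat) *
              (x.sgn * y.sgn * z.sgn) := by
            simp only [mul_assoc, mul_left_comm, mul_comm]
        _ = _ := by rw [h]; simp only [mul_assoc, mul_left_comm, mul_comm])
  (fun x => by ext1 <;> simp [cocycle_one_left])
  (fun x => by
    ext1
    · simp
    · simp only [mul_sgn, inv_mat, inv_sgn, one_sgn]
      rw [← mul_assoc, Int.units_mul_self, one_mul, Int.units_mul_self])

end Mp

/-! ### The elements `m̃`, `ã`, `ñ`, `ñ₋`, `k̃`, `s̃` -/

def mTilde (ε₁ ε₂ : ℤˣ) : Mp :=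
  ⟨⟨!![((ε₁ : ℤ) : ℝ), 0; 0, ((ε₁ : ℤ) : ℝ)], by
    rcases Int.units_eq_one_or ε₁ with h | h <;> simp [h, Matrix.det_fin_two]⟩, ε₂⟩

def aTilde (u : ℝ) (hu : 0 < u) : Mp :=
  ⟨⟨!![u, 0; 0, u⁻¹], by simp [Matrix.det_fin_two, hu.ne']⟩, 1⟩

def nTilde (x : ℝ) : Mp := ⟨⟨!![1, x; 0, 1], by simp [Matrix.det_fin_two]⟩, 1⟩

def nMinusTilde (x : ℝ) : Mp := ⟨⟨!![1, 0; x, 1], by simp [Matrix.det_fin_two]⟩, 1⟩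

theorem four_pi_pos : 0 < 4 * Real.pi := by positivity

/-- The sign `ε(θ)`: equal to `1` on `[-π, π)`, to `-1` on the rest of `[-2π, 2π)`, and extended
to `ℝ` with period `4π`. -/
def kSign (θ : ℝ) : ℤˣ :=
  if toIcoMod four_pi_pos (-(2 * Real.pi)) θ ∈ Ico (-Real.pi) Real.pi then 1 else -1

def kTilde (θ : ℝ) : Mp :=
  ⟨⟨!![Real.cos θ, -Real.sin θ; Real.sin θ, Real.cos θ], by
    rw [Matrix.det_fin_two_of]; nlinarith [Real.sin_sq_add_cos_sq θ]⟩, kSign θ⟩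

def sTilde : Mp := kTilde (Real.pi / 2)

/-! ### The smooth structure

The map `(θ, u, x) ↦ k̃_θ ã_u ñ₋_x` from `(ℝ / 4πℤ) × ℝ_{>0} × ℝ` onto the group (Iwasawa
decomposition) is a diffeomorphism.  With the polar coordinates `w = u e^{iθ/2}` on the punctured
plane, this says that `(w, x) ↦ k̃_{2 arg w} ã_{|w|} ñ₋_x` is a diffeomorphism from
`(ℂ ∖ {0}) × ℝ` onto the group; its inverse is used as a global chart. -/

theorem kSign_add_two_pi (θ : ℝ) : kSign (θ + 2 * Real.pi) = -kSign θ := by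
  have hpi := Real.pi_pos
  obtain ⟨h1, z, hz⟩ := (toIcoMod_eq_iff four_pi_pos (a := -(2 * Real.pi)) (b := θ)).1 rfl
  set t := toIcoMod four_pi_pos (-(2 * Real.pi)) θ with ht
  have h1l := h1.1
  have h1r := h1.2
  by_cases h : t < 0
  · have e : toIcoMod four_pi_pos (-(2 * Real.pi)) (θ + 2 * Real.pi) = t + 2 * Real.pi := by
      rw [toIcoMod_eq_iff]
      refine ⟨⟨by linarith, by linarith⟩, z, by linarith⟩
    unfold kSign
    rw [e, ← ht]
    by_cases h' : -Real.pi ≤ t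
    · rw [if_neg (by rintro ⟨_, _⟩; linarith), if_pos ⟨h', by linarith⟩]
    · rw [if_pos ⟨by linarith, by linarith⟩, if_neg (fun hh => h' hh.1), neg_neg]
  · have e : toIcoMod four_pi_pos (-(2 * Real.pi)) (θ + 2 * Real.pi) = t - 2 * Real.pi := by
      rw [toIcoMod_eq_iff]
      refine ⟨⟨by linarith, by linarith⟩, z + 1, by rw [add_smul, one_smul]; linarith⟩
    unfold kSign
    rw [e, ← ht]
    by_cases h' : t < Real.pi
    · rw [if_neg (by rintro ⟨_, _⟩; linarith), if_pos ⟨by linarith, h'⟩]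
    · rw [if_pos ⟨by linarith, by linarith⟩, if_neg (fun hh => h' hh.2), neg_neg]

theorem kSign_add_int_mul (θ : ℝ) (n : ℤ) :
    kSign (θ + n * (2 * Real.pi)) = (-1) ^ n * kSign θ := by
  induction n using Int.induction_on with
  | zero => simp
  | succ n ih =>
    have : θ + ((n + 1 : ℤ) : ℝ) * (2 * Real.pi) = θ + ((n : ℤ) : ℝ) * (2 * Real.pi) +
        2 * Real.pi := by push_cast; ring
    rw [this, kSign_add_two_pi, ih, zpow_add_one]; simp
  | pred n ih =>
    have h := kSign_add_two_pi (θ + ((-n - 1 : ℤ) : ℝ) * (2 * Real.pi))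
    have : θ + ((-n - 1 : ℤ) : ℝ) * (2 * Real.pi) + 2 * Real.pi =
        θ + ((-n : ℤ) : ℝ) * (2 * Real.pi) := by push_cast; ring
    rw [this, ih] at h
    rw [zpow_sub_one, ← neg_inj, ← h]
    simp

theorem kTilde_add_four_pi_mul (θ : ℝ) (n : ℤ) :
    kTilde (θ + n * (4 * Real.pi)) = kTilde θ := by
  have e : θ + n * (4 * Real.pi) = θ + ((2 * n : ℤ) : ℝ) * (2 * Real.pi) := by push_cast; ring
  ext1
  · ext i j
    rw [e]
    fin_cases i <;> fin_cases j <;>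
      simp [kTilde, -Int.cast_mul, Real.cos_add_int_mul_two_pi, Real.sin_add_int_mul_two_pi]
  · change kSign _ = kSign _
    rw [e, kSign_add_int_mul, zpow_mul]
    simp

/-- The Iwasawa parametrisation `(w, x) ↦ k̃_{2 arg w} ã_{|w|} ñ₋_x`. -/
def iwasawa (p : {w : ℂ // w ≠ 0} × ℝ) : Mp :=
  kTilde (2 * Complex.arg p.1) * aTilde ‖(p.1 : ℂ)‖ (norm_pos_iff.2 p.1.2) * nMinusTilde p.2

theorem kan_mat (θ u x : ℝ) (hu : 0 < u) :
    ((kTilde θ * aTilde u hu * nMinusTilde x).mat : Matrix (Fin 2) (Fin 2) ℝ) =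
      !![Real.cos θ * u - Real.sin θ * u⁻¹ * x, -(Real.sin θ * u⁻¹);
         Real.sin θ * u + Real.cos θ * u⁻¹ * x, Real.cos θ * u⁻¹] := by
  rw [Mp.mul_mat, Mp.mul_mat, Matrix.SpecialLinearGroup.coe_mul, Matrix.SpecialLinearGroup.coe_mul]
  change (!![Real.cos θ, -Real.sin θ; Real.sin θ, Real.cos θ] * !![u, 0; 0, u⁻¹]) *
    !![1, 0; x, 1] = _
  simp [sub_eq_add_neg]

theorem iwasawa_polar (θ u x : ℝ) (hu : 0 < u) :
    iwasawa (⟨u * Complex.exp ((θ / 2 : ℝ) * Complex.I), by simp [hu.ne']⟩, x) =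
      kTilde θ * aTilde u hu * nMinusTilde x := by
  have h1 : ‖(u : ℂ) * Complex.exp ((θ / 2 : ℝ) * Complex.I)‖ = u := by
    rw [norm_mul, Complex.norm_exp_ofReal_mul_I, mul_one, Complex.norm_real, Real.norm_eq_abs,
      abs_of_pos hu]
  have h2 : kTilde (2 * Complex.arg ((u : ℂ) * Complex.exp ((θ / 2 : ℝ) * Complex.I))) =
      kTilde θ := by
    rw [Complex.arg_real_mul _ hu, Complex.arg_exp_mul_I, toIocMod]
    have := kTilde_add_four_pi_mul θ (-toIocDiv Real.two_pi_pos (-Real.pi) (θ / 2))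
    rw [← this]
    congr 1
    simp only [zsmul_eq_mul]
    push_cast
    ring
  have h3 : ∀ (u' : ℝ) (hu' : 0 < u'), u' = u → aTilde u' hu' = aTilde u hu := by
    intro u' hu' e; subst e; rfl
  unfold iwasawa
  dsimp only
  rw [h2, h3 _ _ h1]

theorem iwasawa_injective : Function.Injective iwasawa := by
  rintro ⟨⟨w, hw⟩, x⟩ ⟨⟨w', hw'⟩, x'⟩ h
  have hm := congrArg (fun g : Mp => (g.mat : Matrix (Fin 2) (Fin 2) ℝ)) h
  simp only [iwasawa, kan_mat] at hm
  have hu := norm_pos_iff.2 hw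
  have hu' := norm_pos_iff.2 hw'
  have e00 := congrFun (congrFun hm 0) 0
  have e01 := congrFun (congrFun hm 0) 1
  have e10 := congrFun (congrFun hm 1) 0
  have e11 := congrFun (congrFun hm 1) 1
  simp only [Matrix.of_apply, Matrix.cons_val', Matrix.cons_val_zero, Matrix.cons_val_one,
    Matrix.cons_val_fin_one, neg_inj] at e00 e01 e10 e11
  have t := Real.sin_sq_add_cos_sq (2 * Complex.arg w)
  have t' := Real.sin_sq_add_cos_sq (2 * Complex.arg w')
  have huu : ‖w‖⁻¹ = ‖w'‖⁻¹ := by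
    have : (‖w‖⁻¹) ^ 2 = (‖w'‖⁻¹) ^ 2 := by
      calc (‖w‖⁻¹) ^ 2 = (Real.sin (2 * Complex.arg w) * ‖w‖⁻¹) ^ 2 +
            (Real.cos (2 * Complex.arg w) * ‖w‖⁻¹) ^ 2 := by
            linear_combination -(‖w‖⁻¹) ^ 2 * t
        _ = _ := by rw [e01, e11]; linear_combination (‖w'‖⁻¹) ^ 2 * t'
    exact (pow_left_inj₀ (by positivity) (by positivity) two_ne_zero).1 this
  have hn : ‖w‖ = ‖w'‖ := inv_injective huu
  rw [huu] at e01 e11 e00 e10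
  rw [hn] at e00 e10
  have hi : ‖w'‖⁻¹ ≠ 0 := by positivity
  have es := mul_right_cancel₀ hi e01
  have ec := mul_right_cancel₀ hi e11
  rw [es, ec] at e00 e10
  have hx : x = x' := by
    have : ‖w'‖⁻¹ * x = ‖w'‖⁻¹ * x' := by
      linear_combination (-Real.sin (2 * Complex.arg w')) * e00 +
        Real.cos (2 * Complex.arg w') * e10 - ‖w'‖⁻¹ * (x - x') * t'
    exact mul_left_cancel₀ hi this
  subst hx
  have h3 : ∀ (u v : ℝ) (hu : 0 < u) (hv : 0 < v), u = v → aTilde u hu = aTilde v hv := by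
    intro u v hu hv e; subst e; rfl
  have hk : kTilde (2 * Complex.arg w) = kTilde (2 * Complex.arg w') := by
    unfold iwasawa at h
    dsimp only at h
    rw [h3 _ _ hu hu' hn] at h
    exact mul_right_cancel (mul_right_cancel h)
  have hsgn : kSign (2 * Complex.arg w) = kSign (2 * Complex.arg w') := congrArg Mp.sgn hk
  obtain ⟨n, hn2⟩ := Real.Angle.angle_eq_iff_two_pi_dvd_sub.1
    (Real.Angle.cos_sin_inj ec es)
  have hθ : 2 * Complex.arg w = 2 * Complex.arg w' + n * (2 * Real.pi) := by linarith
  rw [hθ, kSign_add_int_mul] at hsgn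
  have hpar : ((-1 : ℤˣ)) ^ n = 1 := mul_eq_right.1 hsgn
  have hev : Even n := by
    rcases Int.even_or_odd n with he | ho
    · exact he
    · rw [ho.neg_one_zpow] at hpar
      exact absurd hpar (by decide)
  obtain ⟨m, rfl⟩ := hev
  have hpi := Real.pi_pos
  have b1 := Complex.neg_pi_lt_arg w
  have b2 := Complex.arg_le_pi w
  have b3 := Complex.neg_pi_lt_arg w'
  have b4 := Complex.arg_le_pi w'
  push_cast at hθ
  have hm0 : m = 0 := by
    have m1 : m < 1 := by
      by_contra hc
      have : (1 : ℝ) ≤ m := by exact_mod_cast not_lt.1 hc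
      nlinarith
    have m2 : -1 < m := by
      by_contra hc
      have : (m : ℝ) ≤ -1 := by exact_mod_cast not_lt.1 hc
      nlinarith
    omega
  subst hm0
  have harg : Complex.arg w = Complex.arg w' := by
    push_cast at hθ; linarith
  have : w = w' := Complex.ext_norm_arg hn harg
  subst this
  rfl

/-- The `A`-coordinate `u` in the Iwasawa decomposition `g̃ = k̃_θ ã_u ñ₋_x`; the second column of
`k̃_θ ã_u ñ₋_x` is `u⁻¹ (-sin θ, cos θ)`. -/
def iwasawaA (g : Mp) : ℝ := (Real.sqrt ((g.mat 0 1) ^ 2 + (g.mat 1 1) ^ 2))⁻¹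

theorem iwasawaA_kan (θ u x : ℝ) (hu : 0 < u) :
    iwasawaA (kTilde θ * aTilde u hu * nMinusTilde x) = u := by
  have h := kan_mat θ u x hu
  have e01 := congrFun (congrFun h 0) 1
  have e11 := congrFun (congrFun h 1) 1
  simp only [Matrix.of_apply, Matrix.cons_val', Matrix.cons_val_zero, Matrix.cons_val_one,
    Matrix.cons_val_fin_one] at e01 e11
  have : (-(Real.sin θ * u⁻¹)) ^ 2 + (Real.cos θ * u⁻¹) ^ 2 = (u⁻¹) ^ 2 := by
    linear_combination (u⁻¹) ^ 2 * Real.sin_sq_add_cos_sq θ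
  unfold iwasawaA
  rw [e01, e11, this, Real.sqrt_sq (by positivity), inv_inv]

theorem iwasawa_surjective : Function.Surjective iwasawa := by
  intro g
  set a := g.mat 0 0 with ha
  set b := g.mat 0 1 with hb
  set c := g.mat 1 0 with hc
  set d := g.mat 1 1 with hd
  have hdet : a * d - b * c = 1 := by
    have := g.mat.det_coe
    rwa [Matrix.det_fin_two] at this
  have hz : (⟨d, -b⟩ : ℂ) ≠ 0 := by
    intro h
    have h1 := congrArg Complex.re h
    have h2 := congrArg Complex.im h
    simp only [Complex.zero_re, Complex.zero_im, neg_eq_zero] at h1 h2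
    rw [h1, h2] at hdet
    norm_num at hdet
  set r := ‖(⟨d, -b⟩ : ℂ)‖ with hr
  have hrpos : 0 < r := norm_pos_iff.2 hz
  have hr2 : r ^ 2 = b ^ 2 + d ^ 2 := by
    rw [hr, ← Complex.normSq_eq_norm_sq, Complex.normSq_apply]; ring
  set θ := Complex.arg ⟨d, -b⟩ with hθ
  have hcos : r * Real.cos θ = d := Complex.norm_mul_cos_arg _
  have hsin : r * Real.sin θ = -b := Complex.norm_mul_sin_arg _
  have mat_eq : ∀ n : ℤ, (kTilde (θ + n * (2 * Real.pi)) * aTilde r⁻¹ (inv_pos.2 hrpos) *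
      nMinusTilde ((a * b + c * d) / r ^ 2)).mat = g.mat := by
    intro n
    apply Subtype.ext
    rw [kan_mat, Real.cos_add_int_mul_two_pi, Real.sin_add_int_mul_two_pi]
    have hc' : Real.cos θ = d / r := by rw [← hcos]; field_simp
    have hs' : Real.sin θ = -b / r := by rw [← hsin]; field_simp
    rw [hc', hs', inv_inv]
    ext i j
    fin_cases i <;> fin_cases j
    · change d / r * r⁻¹ - -b / r * r * ((a * b + c * d) / r ^ 2) = a
      field_simp
      rw [hr2]
      linear_combination (-d) * hdet
    · change -(-b / r * r) = b
      field_simp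
    · change -b / r * r⁻¹ + d / r * r * ((a * b + c * d) / r ^ 2) = c
      field_simp
      rw [hr2]
      linear_combination b * hdet
    · change d / r * r = d
      field_simp
  have main : ∃ n : ℤ, kTilde (θ + n * (2 * Real.pi)) * aTilde r⁻¹ (inv_pos.2 hrpos) *
      nMinusTilde ((a * b + c * d) / r ^ 2) = g := by
    by_cases h : (kTilde (θ + (0 : ℤ) * (2 * Real.pi)) * aTilde r⁻¹ (inv_pos.2 hrpos) *
      nMinusTilde ((a * b + c * d) / r ^ 2)).sgn = g.sgn
    · exact ⟨0, Mp.ext (mat_eq 0) h⟩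
    · refine ⟨1, Mp.ext (mat_eq 1) ?_⟩
      have hk : (kTilde (θ + (1 : ℤ) * (2 * Real.pi))).mat =
          (kTilde (θ + (0 : ℤ) * (2 * Real.pi))).mat := by
        apply Subtype.ext
        simp [kTilde]
      have hs : (kTilde (θ + (1 : ℤ) * (2 * Real.pi))).sgn =
          -(kTilde (θ + (0 : ℤ) * (2 * Real.pi))).sgn := by
        change kSign _ = -kSign _
        rw [kSign_add_int_mul, kSign_add_int_mul]; simp
      simp only [Mp.mul_sgn, Mp.mul_mat, hk, hs] at h ⊢
      rw [mul_neg, neg_mul, mul_neg, neg_mul]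
      exact (Int.units_ne_iff_eq_neg.1 (Ne.symm h)).symm
  obtain ⟨n, hn⟩ := main
  exact ⟨_, (iwasawa_polar _ _ _ _).trans hn⟩

def iwasawaEquiv : {w : ℂ // w ≠ 0} × ℝ ≃ Mp :=
  Equiv.ofBijective iwasawa ⟨iwasawa_injective, iwasawa_surjective⟩

instance : TopologicalSpace Mp := TopologicalSpace.coinduced iwasawaEquiv inferInstance

def iwasawaHomeomorph : {w : ℂ // w ≠ 0} × ℝ ≃ₜ Mp :=
  iwasawaEquiv.toHomeomorph (fun _ => isOpen_coinduced.symm)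

/-- The global chart `k̃_θ ã_u ñ₋_x ↦ (u e^{iθ/2}, x)`. -/
def iwasawaChart (g : Mp) : ℂ × ℝ :=
  (((iwasawaHomeomorph.symm g).1 : ℂ), (iwasawaHomeomorph.symm g).2)

theorem iwasawaChart_isOpenEmbedding : Topology.IsOpenEmbedding iwasawaChart := by
  have h1 : Topology.IsOpenEmbedding (Prod.map (Subtype.val : {w : ℂ // w ≠ 0} → ℂ) (id : ℝ → ℝ)) :=
    (isOpen_ne.isOpenEmbedding_subtypeVal).prodMap Topology.IsOpenEmbedding.id
  exact h1.comp iwasawaHomeomorph.symm.isOpenEmbedding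

instance : ChartedSpace (ℂ × ℝ) Mp := iwasawaChart_isOpenEmbedding.singletonChartedSpace

instance : IsManifold 𝓘(ℝ, ℂ × ℝ) ∞ Mp :=
  iwasawaChart_isOpenEmbedding.isManifold_singleton

/-! ### Principal series -/

/-- `σ_ε` on `m̃_{ε₁,ε₂}`: `σ_ε(1, ±1) = ±1` and `σ_ε(-1, ±1) = ∓ ε i`. -/
def sigmaChar (ε ε₁ ε₂ : ℤˣ) : ℂ :=
  if ε₁ = 1 then ((ε₂ : ℤ) : ℂ) else -((ε₂ : ℤ) : ℂ) * ((ε : ℤ) : ℂ) * Complex.I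

/-- `ω_{ε,ν}(m̃ ã_u ñ₋) = σ_ε(m̃) u^{ν-1}`, as a function of the parameters of `m̃` and `ã_u`. -/
def omegaChar (ε : ℤˣ) (ν : ℂ) (ε₁ ε₂ : ℤˣ) (u : ℝ) : ℂ := sigmaChar ε ε₁ ε₂ * (u : ℂ) ^ (ν - 1)

/-- The smooth principal series space `V_{ε,ν}^∞`: smooth functions on the metaplectic group with
`f(g̃ b̃) = ω_{ε,ν}(b̃⁻¹) f(g̃)` for all `b̃ ∈ B̃`, where `b̃⁻¹ = m̃ ã ñ₋` runs through
`B̃ = M̃ Ã Ñ₋`. -/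
def principalSeries (ε : ℤˣ) (ν : ℂ) : Submodule ℂ (Mp → ℂ) where
  carrier := {f | ContMDiff 𝓘(ℝ, ℂ × ℝ) 𝓘(ℝ, ℂ) ∞ f ∧
    ∀ (g b : Mp) (ε₁ ε₂ : ℤˣ) (u : ℝ) (hu : 0 < u) (x : ℝ),
      b⁻¹ = mTilde ε₁ ε₂ * aTilde u hu * nMinusTilde x →
        f (g * b) = omegaChar ε ν ε₁ ε₂ u * f g}
  zero_mem' := ⟨contMDiff_const, by intros; simp⟩
  add_mem' := by
    rintro f₁ f₂ ⟨h1, h1'⟩ ⟨h2, h2'⟩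
    refine ⟨h1.add h2, ?_⟩
    intro g b ε₁ ε₂ u hu x hb
    simp only [Pi.add_apply, h1' g b ε₁ ε₂ u hu x hb, h2' g b ε₁ ε₂ u hu x hb, mul_add]
  smul_mem' := by
    rintro c f ⟨h1, h1'⟩
    refine ⟨((contDiff_const (c := c)).mul contDiff_id).contMDiff.comp h1, ?_⟩
    intro g b ε₁ ε₂ u hu x hb
    simp only [Pi.smul_apply, h1' g b ε₁ ε₂ u hu x hb, smul_eq_mul, mul_left_comm]

/-! ### The intertwining operators -/

/-- For `f ∈ V_{ε,-ν}^∞`, the element of `V_{ε,-μ}^∞` with the same restriction to `K̃` as `f`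
(the identification of the compact picture): elements `f` of `V_{ε,-μ}^∞` satisfy
`f(k̃ ã_u ñ₋) = u^{μ+1} f(k̃)`. -/
def transport (ν μ : ℂ) (f : Mp → ℂ) (g : Mp) : ℂ := f g * (iwasawaA g : ℂ) ^ (μ - ν)

/-- `F` is the meromorphic continuation to `ℂ`, in the parameter `μ`, of the absolutely convergent
integral `∫ f_μ(g̃ s̃ ñ_t) dt`, `Re μ > 0`, where `f_μ ∈ V_{ε,-μ}^∞` has the same restriction to `K̃`
as `f ∈ V_{ε,-ν}^∞`.  The normal form only fixes the values of `F` at points of a discrete set: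
removable singularities are removed. -/
def IsIntertwiningContinuation (ν : ℂ) (f : Mp → ℂ) (g : Mp) (F : ℂ → ℂ) : Prop :=
  MeromorphicNFOn F univ ∧
    ∀ μ : ℂ, 0 < μ.re →
      Integrable (fun t : ℝ => transport ν μ f (g * sTilde * nTilde t)) ∧
        F μ = ∫ t : ℝ, transport ν μ f (g * sTilde * nTilde t)

/-- The operator `I_{ε,ν}` is defined on `f ∈ V_{ε,-ν}^∞`: at every point of the group the
meromorphic continuation of the integral exists and has no pole at `ν`. -/
def IntertwiningDefinedAt (ν : ℂ) (f : Mp → ℂ) : Prop :=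
  ∀ g : Mp, ∃ F : ℂ → ℂ, IsIntertwiningContinuation ν f g F ∧ AnalyticAt ℂ F ν

open Classical in
/-- The intertwining operator `I_{ε,ν}` on `V_{ε,-ν}^∞`: the value at `ν` of the meromorphic
continuation of the integral, so `∫ f(g̃ s̃ ñ_t) dt` if `Re ν > 0`.  The formula does not
involve `ε`. -/
def intertwining (ν : ℂ) (f : Mp → ℂ) (g : Mp) : ℂ :=
  if h : ∃ F : ℂ → ℂ, IsIntertwiningContinuation ν f g F then h.choose ν else 0

/-- `φ` is a vector `φ_{ε,ν,ℓ}` of `V_{ε,ν}^∞`: on `K̃` it is the character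
`k̃_θ ↦ exp(-ε (1/2 + ℓ) i θ)`. -/
def IsKVector (ε : ℤˣ) (ν : ℂ) (ℓ : ℤ) (φ : Mp → ℂ) : Prop :=
  φ ∈ principalSeries ε ν ∧
    ∀ θ : ℝ, φ (kTilde θ) = Complex.exp (-((ε : ℤ) : ℂ) * (1 / 2 + (ℓ : ℂ)) * Complex.I * (θ : ℂ))

end Metaplectic

end

/-!
By the Iwasawa decomposition an element of `V_{ε,ν}^∞` is determined by its restriction to `K̃`, a
smooth function `h(θ)` whose Fourier series runs over the characters `e^{iλθ}` with
`λ = 2n - ε/2`. Writing `k̃_θ s̃ ñ_t` in Iwasawa coordinates turns the intertwining integral into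
`∫ (1 + t²)^{-(1+ν)/2} h(θ + π/2 - arctan t) dt`, which is diagonal in this basis: on `e^{iλθ}` it
is Cauchy's beta integral, that is `Γ(ν)` times an entire function of `ν` built from reciprocal
Gamma functions. On compact sets of `ν` these multipliers grow at most polynomially in `λ`,
whereas the Fourier coefficients of `h` decay rapidly, so the resulting series continues the
integral, with poles at most at those of `Γ(ν)`. On each character the composition `I_{-ν} I_ν` is
evaluated by the reflection formula, in which `λ` enters only through `cos (π λ) = 0`.
-/

noncomputable section

namespace Metaplectic

open Filter Topology
open scoped FourierTransform

/-! ### Relations in the metaplectic group -/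

@[simp] theorem mTilde_coe (ε₁ ε₂ : ℤˣ) : ((mTilde ε₁ ε₂).mat : Matrix (Fin 2) (Fin 2) ℝ) =
    !![((ε₁ : ℤ) : ℝ), 0; 0, ((ε₁ : ℤ) : ℝ)] := rfl

@[simp] theorem aTilde_coe (u : ℝ) (hu : 0 < u) :
    ((aTilde u hu).mat : Matrix (Fin 2) (Fin 2) ℝ) = !![u, 0; 0, u⁻¹] := rfl

@[simp] theorem nTilde_coe (x : ℝ) :
    ((nTilde x).mat : Matrix (Fin 2) (Fin 2) ℝ) = !![1, x; 0, 1] := rfl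

@[simp] theorem nMinusTilde_coe (x : ℝ) :
    ((nMinusTilde x).mat : Matrix (Fin 2) (Fin 2) ℝ) = !![1, 0; x, 1] := rfl

@[simp] theorem kTilde_coe (θ : ℝ) : ((kTilde θ).mat : Matrix (Fin 2) (Fin 2) ℝ) =
    !![Real.cos θ, -Real.sin θ; Real.sin θ, Real.cos θ] := rfl

@[simp] theorem sTilde_coe : (sTilde.mat : Matrix (Fin 2) (Fin 2) ℝ) = !![0, -1; 1, 0] := by
  simp [sTilde]

@[simp] theorem aTilde_sgn (u : ℝ) (hu : 0 < u) : (aTilde u hu).sgn = 1 := rfl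

@[simp] theorem nTilde_sgn (x : ℝ) : (nTilde x).sgn = 1 := rfl

@[simp] theorem nMinusTilde_sgn (x : ℝ) : (nMinusTilde x).sgn = 1 := rfl

@[simp] theorem kTilde_sgn (θ : ℝ) : (kTilde θ).sgn = kSign θ := rfl

section Cocycle

theorem hilbertSymbol_eq_one_of_pos_left {x : ℝ} (hx : 0 < x) (y : ℝ) : hilbertSymbol x y = 1 :=
  if_neg fun h => h.1.not_gt hx

theorem hilbertSymbol_eq_one_of_pos_right (x : ℝ) {y : ℝ} (hy : 0 < y) : hilbertSymbol x y = 1 :=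
  if_neg fun h => h.2.not_gt hy

variable {h : SL(2, ℝ)} (h₀ : h 1 0 = 0) (h₁ : 0 < h 1 1) (g : SL(2, ℝ))
include h₀ h₁

theorem kubotaX_mul_left_of_upper : kubotaX (h * g) = h 1 1 * kubotaX g := by
  have e (j : Fin 2) : (h * g) 1 j = h 1 1 * g 1 j := by
    simp [Matrix.mul_apply, Fin.sum_univ_two, h₀]
  simp only [kubotaX, e, mul_ne_zero_iff, h₁.ne', ne_eq, not_false_eq_true, true_and, mul_ite]

theorem kubotaX_mul_right_of_upper : ∃ r > 0, kubotaX (g * h) = r * kubotaX g := by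
  have hdet : h 0 0 * h 1 1 = 1 := by
    simpa only [Matrix.det_fin_two, h₀, mul_zero, sub_zero] using h.det_coe
  have hpos : 0 < h 0 0 := pos_of_mul_pos_left (hdet.symm ▸ one_pos) h₁.le
  have e : (g * h) 1 0 = h 0 0 * g 1 0 := by
    simp [Matrix.mul_apply, Fin.sum_univ_two, h₀, mul_comm]
  by_cases hg : g 1 0 = 0
  · exact ⟨h 1 1, h₁, by simp [kubotaX, e, hg, Matrix.mul_apply, Fin.sum_univ_two, mul_comm]⟩
  · exact ⟨h 0 0, hpos, by simp [kubotaX, e, hg, hpos.ne']⟩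

theorem cocycle_eq_one_of_upper_left : cocycle h g = 1 :=
  hilbertSymbol_eq_one_of_pos_right _ <| by
    rwa [kubotaX_mul_left_of_upper h₀ h₁, mul_div_cancel_right₀ _ (kubotaX_ne_zero g)]

theorem cocycle_eq_one_of_upper_right : cocycle g h = 1 := by
  obtain ⟨r, hr, e⟩ := kubotaX_mul_right_of_upper h₀ h₁ g
  exact hilbertSymbol_eq_one_of_pos_left (by
    rwa [e, mul_div_cancel_right₀ _ (kubotaX_ne_zero g)]) _

end Cocycle

theorem aTilde_mul_sgn (u : ℝ) (hu : 0 < u) (g : Mp) : (aTilde u hu * g).sgn = g.sgn := by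
  rw [Mp.mul_sgn, cocycle_eq_one_of_upper_left] <;> simp [hu]

theorem mul_aTilde_sgn (g : Mp) (u : ℝ) (hu : 0 < u) : (g * aTilde u hu).sgn = g.sgn := by
  rw [Mp.mul_sgn, cocycle_eq_one_of_upper_right] <;> simp [hu]

theorem nTilde_mul_sgn (x : ℝ) (g : Mp) : (nTilde x * g).sgn = g.sgn := by
  rw [Mp.mul_sgn, cocycle_eq_one_of_upper_left] <;> simp

theorem mul_nTilde_sgn (g : Mp) (x : ℝ) : (g * nTilde x).sgn = g.sgn := by
  rw [Mp.mul_sgn, cocycle_eq_one_of_upper_right] <;> simp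

theorem aTilde_one : aTilde 1 one_pos = 1 := by
  ext1
  · ext i j; fin_cases i <;> fin_cases j <;> simp
  · rfl

theorem nMinusTilde_zero : nMinusTilde 0 = 1 := by
  ext1
  · ext i j; fin_cases i <;> fin_cases j <;> simp
  · rfl

theorem aTilde_mul (u v : ℝ) (hu : 0 < u) (hv : 0 < v) :
    aTilde u hu * aTilde v hv = aTilde (u * v) (mul_pos hu hv) := by
  ext1
  · apply Subtype.ext; simp [mul_comm]
  · rw [aTilde_mul_sgn, aTilde_sgn, aTilde_sgn]

theorem nTilde_mul (x y : ℝ) : nTilde x * nTilde y = nTilde (x + y) := by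
  ext1
  · apply Subtype.ext; simp [add_comm]
  · rw [nTilde_mul_sgn, nTilde_sgn, nTilde_sgn]

theorem aTilde_mul_nTilde (u t : ℝ) (hu : 0 < u) :
    aTilde u hu * nTilde t = nTilde (u ^ 2 * t) * aTilde u hu := by
  ext1
  · apply Subtype.ext; simp; field_simp
  · rw [aTilde_mul_sgn, nTilde_mul_sgn, nTilde_sgn, aTilde_sgn]

theorem nMinusTilde_mul_aTilde (x u : ℝ) (hu : 0 < u) :
    nMinusTilde x * aTilde u hu = aTilde u hu * nMinusTilde (u ^ 2 * x) := by
  ext1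
  · apply Subtype.ext; simp; field_simp
  · rw [aTilde_mul_sgn, mul_aTilde_sgn, nMinusTilde_sgn, nMinusTilde_sgn]

theorem aTilde_mul_sTilde (u : ℝ) (hu : 0 < u) :
    aTilde u hu * sTilde = sTilde * aTilde u⁻¹ (inv_pos.2 hu) := by
  ext1
  · apply Subtype.ext; simp
  · rw [aTilde_mul_sgn, mul_aTilde_sgn]

theorem nMinusTilde_mul_sTilde (x : ℝ) : nMinusTilde x * sTilde = sTilde * nTilde (-x) := by
  have hmat : (nMinusTilde x).mat * sTilde.mat = sTilde.mat * (nTilde (-x)).mat := by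
    apply Subtype.ext; simp
  have hX : kubotaX (sTilde.mat * (nTilde (-x)).mat) = 1 := by simp [kubotaX]
  have hs : kubotaX sTilde.mat = 1 := by simp [kubotaX]
  ext1
  · exact hmat
  · rw [mul_nTilde_sgn, Mp.mul_sgn, cocycle, hmat, hX, hs,
      hilbertSymbol_eq_one_of_pos_right _ (by norm_num), nMinusTilde_sgn, one_mul, one_mul]

theorem nMinusTilde_mul (x y : ℝ) : nMinusTilde x * nMinusTilde y = nMinusTilde (x + y) := by
  refine mul_right_cancel (b := sTilde) ?_
  rw [mul_assoc, nMinusTilde_mul_sTilde, ← mul_assoc, nMinusTilde_mul_sTilde, mul_assoc,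
    nTilde_mul, nMinusTilde_mul_sTilde, neg_add]

theorem kSign_eq_one {θ : ℝ} (h : θ ∈ Ico (-Real.pi) Real.pi) : kSign θ = 1 := by
  have hmod : toIcoMod four_pi_pos (-(2 * Real.pi)) θ = θ :=
    (toIcoMod_eq_self _).2 ⟨by linarith [h.1, Real.pi_pos], by linarith [h.2, Real.pi_pos]⟩
  rw [kSign, hmod, if_pos h]

theorem toIcoMod_neg_pi_mem (θ : ℝ) :
    toIcoMod Real.two_pi_pos (-Real.pi) θ ∈ Ico (-Real.pi) Real.pi := by
  have h := toIcoMod_mem_Ico Real.two_pi_pos (-Real.pi) θ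
  exact ⟨h.1, by linarith [h.2]⟩

theorem kSign_eq_zpow (θ : ℝ) : kSign θ = (-1) ^ toIcoDiv Real.two_pi_pos (-Real.pi) θ := by
  conv_lhs => rw [← toIcoMod_add_toIcoDiv_zsmul Real.two_pi_pos (-Real.pi) θ, zsmul_eq_mul]
  rw [kSign_add_int_mul, kSign_eq_one (toIcoMod_neg_pi_mem θ), mul_one]

theorem argL_exp_mul_I (θ : ℝ) :
    argL (Complex.exp (θ * Complex.I)) = toIcoMod Real.two_pi_pos (-Real.pi) θ := by
  refine ((toIcoMod_eq_iff Real.two_pi_pos).2 ⟨?_, ?_⟩).symm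
  · have h := argL_mem (Complex.exp (θ * Complex.I))
    exact ⟨h.1, by linarith [h.2]⟩
  · have h : (θ : Real.Angle) = argL (Complex.exp (θ * Complex.I)) := by
      simpa [argL_coe, Complex.exp_mul_I] using
        (Complex.arg_cos_add_sin_mul_I_coe_angle (θ : Real.Angle)).symm
    obtain ⟨n, hn⟩ := Real.Angle.angle_eq_iff_two_pi_dvd_sub.1 h
    exact ⟨n, by rw [zsmul_eq_mul]; linarith⟩

theorem autFactor_kTilde (θ : ℝ) :
    autFactor (kTilde θ).mat UpperHalfPlane.I = Complex.exp (θ * Complex.I) := by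
  rw [Complex.exp_mul_I]
  simp [autFactor, add_comm]

theorem kTilde_smul_I (θ : ℝ) : (kTilde θ).mat • UpperHalfPlane.I = UpperHalfPlane.I := by
  apply UpperHalfPlane.ext
  have h0 := autFactor_ne_zero (kTilde θ).mat UpperHalfPlane.I
  rw [UpperHalfPlane.specialLinearGroup_apply, div_eq_iff (by simpa [autFactor] using h0)]
  simp only [Algebra.algebraMap_self, Fin.isValue, kTilde_coe, Matrix.of_apply, Matrix.cons_val',
    Matrix.cons_val_zero, Matrix.cons_val_fin_one, Real.ringHom_apply, Complex.ofReal_cos,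
    UpperHalfPlane.coe_I, Matrix.cons_val_one, Complex.ofReal_neg, Complex.ofReal_sin]
  linear_combination -Complex.sin θ * Complex.I_sq

/-- The integer cocycle of two rotations measures the failure of additivity of the arguments of
their automorphy factors `e^{iθ}` at the fixed point `i`; modulo `2` this is the failure of
multiplicativity of `ε(θ)`. -/
theorem kTilde_mul (θ φ : ℝ) : kTilde θ * kTilde φ = kTilde (θ + φ) := by
  have hmat : (kTilde θ).mat * (kTilde φ).mat = (kTilde (θ + φ)).mat := by
    apply Subtype.ext
    simp [Real.cos_add, Real.sin_add]
    constructor <;> ring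
  ext1
  · exact hmat
  have harg := argL_mul (kTilde θ).mat (kTilde φ).mat UpperHalfPlane.I
  simp only [kTilde_smul_I, hmat, autFactor_kTilde, argL_exp_mul_I, toIcoMod, zsmul_eq_mul] at harg
  have hdiv : cocycleZ (kTilde θ).mat (kTilde φ).mat + toIcoDiv Real.two_pi_pos (-Real.pi) θ +
      toIcoDiv Real.two_pi_pos (-Real.pi) φ = toIcoDiv Real.two_pi_pos (-Real.pi) (θ + φ) := by
    have : (2 * Real.pi) ≠ 0 := Real.two_pi_pos.ne'
    refine Int.cast_injective (α := ℝ) (mul_left_cancel₀ this ?_)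
    push_cast
    linarith
  rw [Mp.mul_sgn, cocycle_eq, kTilde_sgn, kTilde_sgn, kTilde_sgn, kSign_eq_zpow, kSign_eq_zpow,
    kSign_eq_zpow, ← zpow_add, ← zpow_add, hdiv]

theorem kTilde_zero : kTilde 0 = mTilde 1 1 := by
  ext1
  · apply Subtype.ext; simp
  · exact kSign_eq_one ⟨by linarith [Real.pi_pos], Real.pi_pos⟩

theorem kTilde_neg_pi : kTilde (-Real.pi) = mTilde (-1) 1 := by
  ext1
  · apply Subtype.ext; simp
  · exact kSign_eq_one ⟨le_rfl, by linarith [Real.pi_pos]⟩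

theorem kTilde_pi : kTilde Real.pi = mTilde (-1) (-1) := by
  ext1
  · apply Subtype.ext; simp
  · change kSign Real.pi = -1
    rw [show Real.pi = -Real.pi + 2 * Real.pi by ring, kSign_add_two_pi,
      kSign_eq_one ⟨le_rfl, by linarith [Real.pi_pos]⟩]

theorem kTilde_two_pi : kTilde (2 * Real.pi) = mTilde 1 (-1) := by
  ext1
  · apply Subtype.ext; simp
  · change kSign (2 * Real.pi) = -1
    rw [← zero_add (2 * Real.pi), kSign_add_two_pi,
      kSign_eq_one ⟨by linarith [Real.pi_pos], Real.pi_pos⟩]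

theorem mTilde_comm (ε₁ ε₂ : ℤˣ) (g : Mp) : mTilde ε₁ ε₂ * g = g * mTilde ε₁ ε₂ := by
  have hmat : (mTilde ε₁ ε₂).mat * g.mat = g.mat * (mTilde ε₁ ε₂).mat := by
    apply Subtype.ext
    ext i j
    fin_cases i <;> fin_cases j <;> simp [Matrix.mul_apply, mul_comm]
  ext1
  · exact hmat
  · simp only [Mp.mul_sgn, cocycle, hmat, hilbertSymbol, and_comm, mul_right_comm]

theorem sqrt_one_add_sq_pos (y : ℝ) : 0 < √(1 + y ^ 2) := Real.sqrt_pos.2 (by positivity)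

theorem nTilde_mul_nMinusTilde_mul_aTilde (y : ℝ) :
    nTilde y * nMinusTilde (-(y / (1 + y ^ 2))) * aTilde √(1 + y ^ 2) (sqrt_one_add_sq_pos y) =
      kTilde (-Real.arctan y) := by
  have hr : √(1 + y ^ 2) ≠ 0 := (sqrt_one_add_sq_pos y).ne'
  have hr2 : √(1 + y ^ 2) ^ 2 = 1 + y ^ 2 := Real.sq_sqrt (by positivity)
  ext1
  · apply Subtype.ext
    ext i j
    fin_cases i <;> fin_cases j <;>
      simp [Real.cos_arctan, Real.sin_arctan] <;> field_simp <;> simp [hr2]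
  · rw [mul_aTilde_sgn, nTilde_mul_sgn, nMinusTilde_sgn, kTilde_sgn, kSign_eq_one]
    constructor <;>
      linarith [Real.arctan_lt_pi_div_two y, Real.neg_pi_div_two_lt_arctan y, Real.pi_pos]

theorem nTilde_eq_kan (y : ℝ) : nTilde y = kTilde (-Real.arctan y) *
    aTilde (√(1 + y ^ 2))⁻¹ (inv_pos.2 (sqrt_one_add_sq_pos y)) *
      nMinusTilde (y / (1 + y ^ 2)) := by
  have ha : aTilde √(1 + y ^ 2) (sqrt_one_add_sq_pos y) *
      aTilde (√(1 + y ^ 2))⁻¹ (inv_pos.2 (sqrt_one_add_sq_pos y)) = 1 := by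
    simp only [aTilde_mul, mul_inv_cancel₀ (sqrt_one_add_sq_pos y).ne', aTilde_one]
  rw [← nTilde_mul_nMinusTilde_mul_aTilde, mul_assoc (_ * _) (aTilde _ _) (aTilde _ _), ha,
    mul_one, mul_assoc, nMinusTilde_mul, neg_add_cancel, nMinusTilde_zero, mul_one]

theorem exists_kan (g : Mp) : ∃ (θ u x : ℝ) (hu : 0 < u),
    g = kTilde θ * aTilde u hu * nMinusTilde x := by
  obtain ⟨p, rfl⟩ := iwasawa_surjective g
  exact ⟨_, _, _, _, rfl⟩

theorem aTilde_mul_nMinusTilde_mul_sTilde_mul_nTilde (u x t : ℝ) (hu : 0 < u) :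
    aTilde u hu * nMinusTilde x * sTilde * nTilde t =
      sTilde * nTilde ((t - x) / u ^ 2) * aTilde u⁻¹ (inv_pos.2 hu) := by
  calc aTilde u hu * nMinusTilde x * sTilde * nTilde t
      = aTilde u hu * sTilde * nTilde (t - x) := by
        rw [mul_assoc (aTilde u hu), nMinusTilde_mul_sTilde, ← mul_assoc, mul_assoc, nTilde_mul,
          neg_add_eq_sub]
    _ = sTilde * (nTilde (u⁻¹ ^ 2 * (t - x)) * aTilde u⁻¹ (inv_pos.2 hu)) := by
        rw [aTilde_mul_sTilde, mul_assoc, aTilde_mul_nTilde]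
    _ = _ := by rw [← mul_assoc, inv_pow, inv_mul_eq_div]

theorem kan_mul_sTilde_mul_nTilde (θ u x t : ℝ) (hu : 0 < u) :
    ∃ z : ℝ, kTilde θ * aTilde u hu * nMinusTilde x * sTilde * nTilde t =
      kTilde (θ + Real.pi / 2 - Real.arctan ((t - x) / u ^ 2)) *
        aTilde ((√(1 + ((t - x) / u ^ 2) ^ 2))⁻¹ * u⁻¹)
          (mul_pos (inv_pos.2 (sqrt_one_add_sq_pos _)) (inv_pos.2 hu)) * nMinusTilde z := by
  set y := (t - x) / u ^ 2 with hy
  refine ⟨u⁻¹ ^ 2 * (y / (1 + y ^ 2)), ?_⟩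
  calc kTilde θ * aTilde u hu * nMinusTilde x * sTilde * nTilde t
      = kTilde θ * (sTilde * nTilde y * aTilde u⁻¹ (inv_pos.2 hu)) := by
        rw [hy, ← aTilde_mul_nMinusTilde_mul_sTilde_mul_nTilde u x t hu]; simp only [mul_assoc]
    _ = kTilde θ * kTilde (Real.pi / 2) * kTilde (-Real.arctan y) *
          aTilde (√(1 + y ^ 2))⁻¹ (inv_pos.2 (sqrt_one_add_sq_pos y)) *
            (nMinusTilde (y / (1 + y ^ 2)) * aTilde u⁻¹ (inv_pos.2 hu)) := by
        rw [nTilde_eq_kan, sTilde]; simp only [mul_assoc]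
    _ = _ := by
        rw [nMinusTilde_mul_aTilde, ← mul_assoc, mul_assoc _ (aTilde _ _) (aTilde _ _), aTilde_mul,
          kTilde_mul, kTilde_mul, ← sub_eq_add_neg]

/-! ### The compact picture of the principal series -/

/-- Restrictions to `K̃` of functions in the principal series, written in the coordinate `θ` of
`k̃_θ`: translation by `π`, that is by `k̃_π = m̃_{-1,-1}`, multiplies them by `-ε i`. -/
def IsKEquivariant (ε : ℤˣ) (h : ℝ → ℂ) : Prop :=
  ∀ θ, h (θ + Real.pi) = -(((ε : ℤ) : ℂ) * Complex.I) * h θ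

theorem units_mul_I_sq (ε : ℤˣ) : (((ε : ℤ) : ℂ) * Complex.I) ^ 2 = -1 := by
  rcases Int.units_eq_one_or ε with rfl | rfl <;> simp

theorem IsKEquivariant.apply_add_two_pi {ε : ℤˣ} {h : ℝ → ℂ} (hh : IsKEquivariant ε h) (θ : ℝ) :
    h (θ + 2 * Real.pi) = -h θ := by
  rw [two_mul, ← add_assoc, hh, hh]
  linear_combination h θ * units_mul_I_sq ε

theorem IsKEquivariant.periodic {ε : ℤˣ} {h : ℝ → ℂ} (hh : IsKEquivariant ε h) :
    Function.Periodic h (4 * Real.pi) := fun θ => by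
  rw [show θ + 4 * Real.pi = θ + 2 * Real.pi + 2 * Real.pi by ring, hh.apply_add_two_pi,
    hh.apply_add_two_pi, neg_neg]

/-- The exponents `λ_n = 2n - ε/2` of the characters of `K̃` occurring in the principal series. -/
def kExponent (ε : ℤˣ) (n : ℤ) : ℝ := 2 * n - ((ε : ℤ) : ℝ) / 2

/-- The character `k̃_θ ↦ exp(i λ_n θ)` of `K̃`, as a function of `θ`. -/
def kCharacter (ε : ℤˣ) (n : ℤ) (θ : ℝ) : ℂ :=
  Complex.exp ((kExponent ε n * θ : ℝ) * Complex.I)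

theorem kCharacter_add (ε : ℤˣ) (n : ℤ) (θ φ : ℝ) :
    kCharacter ε n (θ + φ) = kCharacter ε n θ * kCharacter ε n φ := by
  rw [kCharacter, kCharacter, kCharacter, ← Complex.exp_add]
  congr 1; push_cast; ring

theorem kCharacter_pi (ε : ℤˣ) (n : ℤ) :
    kCharacter ε n Real.pi = -(((ε : ℤ) : ℂ) * Complex.I) := by
  have e : ((kExponent ε n * Real.pi : ℝ) : ℂ) * Complex.I =
      (((-(((ε : ℤ) : ℝ) * (Real.pi / 2)) : ℝ) : ℂ) * Complex.I) +
        n * (2 * Real.pi * Complex.I) := by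
    rw [kExponent]; push_cast; ring
  rw [kCharacter, e, Complex.exp_add, Complex.exp_int_mul_two_pi_mul_I, mul_one, Complex.exp_mul_I,
    ← Complex.ofReal_cos, ← Complex.ofReal_sin]
  rcases Int.units_eq_one_or ε with rfl | rfl <;> simp

theorem isKEquivariant_kCharacter (ε : ℤˣ) (n : ℤ) : IsKEquivariant ε (kCharacter ε n) :=
  fun θ => by rw [kCharacter_add, kCharacter_pi, mul_comm]

theorem contDiff_kCharacter (ε : ℤˣ) (n : ℤ) : ContDiff ℝ ∞ (kCharacter ε n) :=
  ((Complex.ofRealCLM.contDiff.comp (contDiff_const.mul contDiff_id)).mul contDiff_const).cexp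

theorem isKVector_add_self_iff {ε : ℤˣ} {ν : ℂ} {j : ℤ} {φ : Mp → ℂ} :
    IsKVector ε ν (j + j) φ ↔
      φ ∈ principalSeries ε ν ∧ ∀ θ, φ (kTilde θ) = kCharacter ε (-ε * j) θ := by
  have e (θ : ℝ) : -((ε : ℤ) : ℂ) * (1 / 2 + ((j + j : ℤ) : ℂ)) * Complex.I * (θ : ℂ) =
      (kExponent ε (-ε * j) * θ : ℝ) * Complex.I := by
    rw [kExponent]; push_cast; ring
  simp only [IsKVector, kCharacter, e]

theorem principalSeries_apply {ε : ℤˣ} {ν : ℂ} {f : Mp → ℂ} (hf : f ∈ principalSeries ε ν)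
    (g : Mp) (ε₁ ε₂ : ℤˣ) (u : ℝ) (hu : 0 < u) (x : ℝ) :
    f g = omegaChar ε ν ε₁ ε₂ u * f (g * (mTilde ε₁ ε₂ * aTilde u hu * nMinusTilde x)) := by
  simpa only [mul_inv_cancel_right] using
    hf.2 (g * (mTilde ε₁ ε₂ * aTilde u hu * nMinusTilde x)) _ ε₁ ε₂ u hu x (inv_inv _)

theorem ofReal_cpow_neg_mul_cpow {u : ℝ} (hu : 0 < u) (z : ℂ) :
    (u : ℂ) ^ (-z) * (u : ℂ) ^ z = 1 := by
  rw [← Complex.cpow_add _ _ (by exact_mod_cast hu.ne'), neg_add_cancel, Complex.cpow_zero]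

theorem kTilde_eq_kan (θ : ℝ) : kTilde θ = kTilde θ * aTilde 1 one_pos * nMinusTilde 0 := by
  rw [aTilde_one, nMinusTilde_zero, mul_one, mul_one]

theorem principalSeries_apply_kan {ε : ℤˣ} {ν : ℂ} {f : Mp → ℂ} (hf : f ∈ principalSeries ε ν)
    (θ u x : ℝ) (hu : 0 < u) :
    f (kTilde θ * aTilde u hu * nMinusTilde x) = (u : ℂ) ^ (1 - ν) * f (kTilde θ) := by
  have hpow := ofReal_cpow_neg_mul_cpow hu (ν - 1)
  rw [neg_sub] at hpow
  rw [principalSeries_apply hf (kTilde θ) 1 1 u hu x, ← mul_assoc (kTilde θ),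
    ← mul_assoc (kTilde θ), ← kTilde_zero, kTilde_mul, add_zero, omegaChar, sigmaChar, if_pos rfl]
  simp [← mul_assoc, hpow]

theorem principalSeries_isKEquivariant {ε : ℤˣ} {ν : ℂ} {f : Mp → ℂ}
    (hf : f ∈ principalSeries ε ν) : IsKEquivariant ε fun θ => f (kTilde θ) := fun θ => by
  have h := principalSeries_apply hf (kTilde θ) (-1) (-1) 1 one_pos 0
  rw [mul_assoc (mTilde _ _), aTilde_one, nMinusTilde_zero, one_mul, mul_one, ← kTilde_pi,
    kTilde_mul] at h
  simp only [h, omegaChar, sigmaChar, if_neg (by decide : (-1 : ℤˣ) ≠ 1)]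
  simp only [Units.val_neg, Units.val_one, Int.cast_neg, Int.cast_one, Complex.ofReal_one,
    Complex.one_cpow]
  linear_combination f (kTilde (θ + Real.pi)) * units_mul_I_sq ε

theorem eq_of_eqOn_kTilde {ε : ℤˣ} {ν : ℂ} {f f' : Mp → ℂ} (hf : f ∈ principalSeries ε ν)
    (hf' : f' ∈ principalSeries ε ν) (h : ∀ θ, f (kTilde θ) = f' (kTilde θ)) : f = f' := by
  ext g
  obtain ⟨θ, u, x, hu, rfl⟩ := exists_kan g
  rw [principalSeries_apply_kan hf, principalSeries_apply_kan hf', h]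

theorem iwasawaChart_kan (θ u x : ℝ) (hu : 0 < u) :
    iwasawaChart (kTilde θ * aTilde u hu * nMinusTilde x) =
      (u * Complex.exp ((θ / 2 : ℝ) * Complex.I), x) := by
  rw [← iwasawa_polar, iwasawaChart]
  exact congrArg (fun p : {w : ℂ // w ≠ 0} × ℝ => ((p.1 : ℂ), p.2))
    (iwasawaHomeomorph.symm_apply_apply _)

theorem iwasawaChart_fst_ne_zero (g : Mp) : (iwasawaChart g).1 ≠ 0 :=
  (iwasawaHomeomorph.symm g).1.2

theorem contMDiff_kTilde : ContMDiff 𝓘(ℝ, ℝ) 𝓘(ℝ, ℂ × ℝ) ∞ kTilde := by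
  refine ContMDiff.of_comp_isOpenEmbedding iwasawaChart_isOpenEmbedding ?_
  have hchart : iwasawaChart ∘ kTilde = fun θ : ℝ =>
      ((1 : ℝ) * Complex.exp ((θ / 2 : ℝ) * Complex.I), (0 : ℝ)) := by
    ext1 θ
    rw [Function.comp_apply, kTilde_eq_kan, iwasawaChart_kan]
  rw [hchart, contMDiff_iff_contDiff]
  have hlin : ContDiff ℝ ∞ fun θ : ℝ => ((θ / 2 : ℝ) : ℂ) * Complex.I :=
    (Complex.ofRealCLM.contDiff.comp (contDiff_id.div_const 2)).mul contDiff_const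
  exact (contDiff_const.mul hlin.cexp).prodMk contDiff_const

theorem principalSeries_contDiff {ε : ℤˣ} {ν : ℂ} {f : Mp → ℂ} (hf : f ∈ principalSeries ε ν) :
    ContDiff ℝ ∞ fun θ => f (kTilde θ) :=
  (hf.1.comp contMDiff_kTilde).contDiff

/-- The function `k̃_θ ã_u ñ₋_x ↦ u^{1-ν} h(θ)` on the group, well defined if `h` has period `4π`;
it inverts the restriction to `K̃` of elements of the principal series. -/
def kExtend (ν : ℂ) (h : ℝ → ℂ) (g : Mp) : ℂ :=
  (‖(iwasawaChart g).1‖ : ℂ) ^ (1 - ν) * h (2 * Complex.arg (iwasawaChart g).1)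

theorem kExtend_kan {h : ℝ → ℂ} (hh : Function.Periodic h (4 * Real.pi)) (ν : ℂ) (θ u x : ℝ)
    (hu : 0 < u) :
    kExtend ν h (kTilde θ * aTilde u hu * nMinusTilde x) = (u : ℂ) ^ (1 - ν) * h θ := by
  have harg : 2 * toIocMod Real.two_pi_pos (-Real.pi) (θ / 2) =
      θ - toIocDiv Real.two_pi_pos (-Real.pi) (θ / 2) * (4 * Real.pi) := by
    rw [toIocMod, zsmul_eq_mul]; ring
  rw [kExtend, iwasawaChart_kan, norm_mul, Complex.norm_exp_ofReal_mul_I, mul_one,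
    Complex.norm_of_nonneg hu.le, Complex.arg_real_mul _ hu, Complex.arg_exp_mul_I, harg,
    hh.sub_int_mul_eq]

theorem kExtend_kTilde {h : ℝ → ℂ} (hh : Function.Periodic h (4 * Real.pi)) (ν : ℂ) (θ : ℝ) :
    kExtend ν h (kTilde θ) = h θ := by
  rw [kTilde_eq_kan, kExtend_kan hh, Complex.ofReal_one, Complex.one_cpow, one_mul]

theorem contDiffAt_arg {w : ℂ} (hw : w ∈ Complex.slitPlane) : ContDiffAt ℝ ∞ Complex.arg w := by
  simpa only [Function.comp_def, Complex.imCLM_apply, Complex.log_im] using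
    Complex.imCLM.contDiff.contDiffAt.comp w ((Complex.contDiffAt_log hw).restrict_scalars ℝ)

/-- Off the slit plane, `2 arg w` is replaced by `2 arg (-w) + 2π`, which differs from it by a
multiple of `4π`. -/
theorem contDiffAt_comp_two_mul_arg {h : ℝ → ℂ} (hper : Function.Periodic h (4 * Real.pi))
    (hsmooth : ContDiff ℝ ∞ h) {w : ℂ} (hw : w ≠ 0) :
    ContDiffAt ℝ ∞ (fun w => h (2 * Complex.arg w)) w := by
  rcases Complex.mem_slitPlane_or_neg_mem_slitPlane hw with hs | hs
  · exact hsmooth.contDiffAt.comp w (contDiffAt_const.mul (contDiffAt_arg hs))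
  have hneg : (fun w => h (2 * Complex.arg w)) =ᶠ[𝓝 w]
      fun w => h (2 * Complex.arg (-w) + 2 * Real.pi) := by
    filter_upwards [isOpen_ne.mem_nhds hw] with z hz
    have harg := Complex.arg_neg_coe_angle hz
    rw [← Real.Angle.coe_add, Real.Angle.angle_eq_iff_two_pi_dvd_sub] at harg
    obtain ⟨k, hk⟩ := harg
    have hk' : 2 * Complex.arg (-z) + 2 * Real.pi =
        2 * Complex.arg z + (k + 1 : ℤ) * (4 * Real.pi) := by
      push_cast; linarith
    rw [hk', hper.int_mul (k + 1)]
  have hshift : ContDiffAt ℝ ∞ (fun w => 2 * Complex.arg (-w) + 2 * Real.pi) w :=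
    (contDiffAt_const.mul ((contDiffAt_arg hs).comp w contDiffAt_id.neg)).add contDiffAt_const
  exact (hsmooth.contDiffAt.comp w hshift).congr_of_eventuallyEq hneg

theorem contDiffAt_norm_cpow (z : ℂ) {w : ℂ} (hw : w ≠ 0) :
    ContDiffAt ℝ ∞ (fun w : ℂ => (‖w‖ : ℂ) ^ z) w := by
  have hlog : ContDiffAt ℝ ∞ (fun w : ℂ => ((Real.log ‖w‖ : ℝ) : ℂ)) w :=
    Complex.ofRealCLM.contDiff.contDiffAt.comp w
      ((contDiffAt_norm ℝ hw).log (norm_ne_zero_iff.2 hw))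
  refine (hlog.mul (contDiffAt_const (c := z))).cexp.congr_of_eventuallyEq ?_
  filter_upwards [isOpen_ne.mem_nhds hw] with w hw
  rw [Complex.cpow_def_of_ne_zero (by simpa using hw), Complex.ofReal_log (norm_nonneg _)]

theorem contMDiff_kExtend {h : ℝ → ℂ} (hper : Function.Periodic h (4 * Real.pi))
    (hsmooth : ContDiff ℝ ∞ h) (ν : ℂ) :
    ContMDiff 𝓘(ℝ, ℂ × ℝ) 𝓘(ℝ, ℂ) ∞ (kExtend ν h) := fun g => by
  have h0 := iwasawaChart_fst_ne_zero g
  have hchart : ContMDiffAt 𝓘(ℝ, ℂ × ℝ) 𝓘(ℝ, ℂ × ℝ) ∞ iwasawaChart g :=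
    (contMDiff_isOpenEmbedding (n := ∞) (I := 𝓘(ℝ, ℂ × ℝ)) iwasawaChart_isOpenEmbedding) g
  have hpolar : ContDiffAt ℝ ∞
      (fun p : ℂ × ℝ => (‖p.1‖ : ℂ) ^ (1 - ν) * h (2 * Complex.arg p.1)) (iwasawaChart g) :=
    ((contDiffAt_norm_cpow (1 - ν) h0).mul (contDiffAt_comp_two_mul_arg hper hsmooth h0)).comp
      (iwasawaChart g) contDiffAt_fst
  exact hpolar.contMDiffAt.comp g hchart

theorem kan_mul_man (θ v y u x : ℝ) (hv : 0 < v) (hu : 0 < u) (ε₁ ε₂ : ℤˣ) :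
    kTilde θ * aTilde v hv * nMinusTilde y * (mTilde ε₁ ε₂ * aTilde u hu * nMinusTilde x) =
      kTilde θ * mTilde ε₁ ε₂ * aTilde (v * u) (mul_pos hv hu) * nMinusTilde (u ^ 2 * y + x) := by
  calc _ = kTilde θ * (mTilde ε₁ ε₂ * (aTilde v hv * nMinusTilde y)) * aTilde u hu *
        nMinusTilde x := by
        rw [mTilde_comm ε₁ ε₂ (aTilde v hv * nMinusTilde y)]; simp only [mul_assoc]
    _ = kTilde θ * mTilde ε₁ ε₂ * aTilde v hv * (nMinusTilde y * aTilde u hu) *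
        nMinusTilde x := by simp only [mul_assoc]
    _ = kTilde θ * mTilde ε₁ ε₂ * (aTilde v hv * aTilde u hu) *
        (nMinusTilde (u ^ 2 * y) * nMinusTilde x) := by
        rw [nMinusTilde_mul_aTilde]; simp only [mul_assoc]
    _ = _ := by rw [aTilde_mul, nMinusTilde_mul]

theorem IsKEquivariant.exists_kTilde_mul_mTilde {ε : ℤˣ} {h : ℝ → ℂ} (hh : IsKEquivariant ε h)
    (θ : ℝ) (ε₁ ε₂ : ℤˣ) :
    ∃ φ, kTilde θ * mTilde ε₁ ε₂ = kTilde φ ∧ sigmaChar ε ε₁ ε₂ * h φ = h θ := by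
  rcases Int.units_eq_one_or ε₁ with rfl | rfl <;> rcases Int.units_eq_one_or ε₂ with rfl | rfl
  · exact ⟨θ + 0, by rw [← kTilde_zero, kTilde_mul], by simp [sigmaChar]⟩
  · exact ⟨θ + 2 * Real.pi, by rw [← kTilde_two_pi, kTilde_mul],
      by simp [sigmaChar, hh.apply_add_two_pi]⟩
  · have h' := hh (θ + -Real.pi)
    rw [neg_add_cancel_right] at h'
    exact ⟨θ + -Real.pi, by rw [← kTilde_neg_pi, kTilde_mul], by simp [sigmaChar, h']⟩
  · refine ⟨θ + Real.pi, by rw [← kTilde_pi, kTilde_mul], ?_⟩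
    rw [hh, sigmaChar, if_neg (by decide)]
    push_cast
    linear_combination (-h θ) * units_mul_I_sq ε

theorem kExtend_mem {ε : ℤˣ} {h : ℝ → ℂ} (hsmooth : ContDiff ℝ ∞ h) (hh : IsKEquivariant ε h)
    (ν : ℂ) : kExtend ν h ∈ principalSeries ε ν := by
  refine ⟨contMDiff_kExtend hh.periodic hsmooth ν, fun g b ε₁ ε₂ u hu x hb => ?_⟩
  obtain ⟨g', rfl⟩ : ∃ g', g = g' * b⁻¹ := ⟨g * b, by simp⟩
  obtain ⟨θ, v, y, hv, rfl⟩ := exists_kan g'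
  obtain ⟨φ, hφ, hσ⟩ := hh.exists_kTilde_mul_mTilde θ ε₁ ε₂
  have hpow := ofReal_cpow_neg_mul_cpow hu (1 - ν)
  rw [neg_sub] at hpow
  rw [inv_mul_cancel_right, hb, kan_mul_man, hφ, kExtend_kan hh.periodic, kExtend_kan hh.periodic,
    omegaChar, ← hσ, Complex.ofReal_mul, Complex.mul_cpow_ofReal_nonneg hv.le hu.le]
  linear_combination (-(v : ℂ) ^ (1 - ν) * sigmaChar ε ε₁ ε₂ * h φ) * hpow

theorem existsUnique_isKVector (ε : ℤˣ) (ν : ℂ) (ℓ : ℤ) (hℓ : Even ℓ) :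
    ∃! φ : Mp → ℂ, IsKVector ε ν ℓ φ := by
  obtain ⟨j, rfl⟩ := hℓ
  have hχ := isKEquivariant_kCharacter ε (-ε * j)
  have hmem := kExtend_mem (contDiff_kCharacter ε (-ε * j)) hχ ν
  refine ⟨kExtend ν (kCharacter ε (-ε * j)),
    isKVector_add_self_iff.2 ⟨hmem, kExtend_kTilde hχ.periodic ν⟩, fun φ hφ => ?_⟩
  obtain ⟨hφmem, hφK⟩ := isKVector_add_self_iff.1 hφ
  exact eq_of_eqOn_kTilde hφmem hmem fun θ => by rw [hφK, kExtend_kTilde hχ.periodic]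

/-! ### Cauchy's beta integral -/

/-- The integrand `(1 + i y)^{-a} (1 - i y)^{-b}` of Cauchy's beta integral. -/
def cauchyKernel (a b : ℂ) (y : ℝ) : ℂ :=
  (1 + y * Complex.I) ^ (-a) * (1 - y * Complex.I) ^ (-b)

/-- Cauchy's beta integral `∫ (1 + i y)^{-a} (1 - i y)^{-b} dy`, convergent if `Re (a + b) > 1`. -/
def cauchyIntegral (a b : ℂ) : ℂ := ∫ y, cauchyKernel a b y

theorem one_add_mul_I_mem_slitPlane (y : ℝ) : 1 + y * Complex.I ∈ Complex.slitPlane :=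
  Or.inl (by simp)

theorem one_sub_mul_I_mem_slitPlane (y : ℝ) : 1 - y * Complex.I ∈ Complex.slitPlane :=
  Or.inl (by simp)

theorem log_one_add_mul_I (y : ℝ) : Complex.log (1 + y * Complex.I) =
    -(Real.log (Real.cos (Real.arctan y)) : ℂ) + Real.arctan y * Complex.I := by
  have hc := Real.cos_arctan_pos y
  have hpolar : 1 + y * Complex.I = ((Real.cos (Real.arctan y))⁻¹ : ℝ) *
      Complex.exp (Real.arctan y * Complex.I) := by
    have hsin : Real.sin (Real.arctan y) = y * Real.cos (Real.arctan y) := by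
      rw [← Real.tan_mul_cos hc.ne', Real.tan_arctan]
    have hc' : (Real.cos (Real.arctan y) : ℂ) ≠ 0 := by exact_mod_cast hc.ne'
    rw [Complex.exp_mul_I, ← Complex.ofReal_cos, ← Complex.ofReal_sin, hsin]
    push_cast at hc' ⊢
    field_simp
  rw [hpolar, Complex.log_ofReal_mul (inv_pos.2 hc) (Complex.exp_ne_zero _), Real.log_inv,
    Complex.ofReal_neg, Complex.log_exp]
  · rw [Complex.mul_I_im, Complex.ofReal_re]
    linarith [Real.neg_pi_div_two_lt_arctan y, Real.pi_pos]
  · rw [Complex.mul_I_im, Complex.ofReal_re]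
    linarith [Real.arctan_lt_pi_div_two y, Real.pi_pos]

theorem cauchyKernel_eq (a b : ℂ) (y : ℝ) : cauchyKernel a b y =
    (Real.cos (Real.arctan y) : ℂ) ^ (a + b) *
      Complex.exp (Real.arctan y * ((b - a) * Complex.I)) := by
  have hc : (Real.cos (Real.arctan y) : ℂ) ≠ 0 := by exact_mod_cast (Real.cos_arctan_pos y).ne'
  have hlog := log_one_add_mul_I (-y)
  rw [Real.arctan_neg, Real.cos_neg, Complex.ofReal_neg, neg_mul, ← sub_eq_add_neg] at hlog
  rw [cauchyKernel, Complex.cpow_def_of_ne_zero hc,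
    Complex.cpow_def_of_ne_zero (Complex.slitPlane_ne_zero (one_add_mul_I_mem_slitPlane y)),
    Complex.cpow_def_of_ne_zero (Complex.slitPlane_ne_zero (one_sub_mul_I_mem_slitPlane y)),
    log_one_add_mul_I, hlog, ← Complex.ofReal_log (Real.cos_arctan_pos y).le, ← Complex.exp_add,
    ← Complex.exp_add]
  congr 1
  push_cast
  ring

theorem norm_cauchyKernel (a b : ℂ) (y : ℝ) : ‖cauchyKernel a b y‖ =
    Real.cos (Real.arctan y) ^ (a + b).re * Real.exp (Real.arctan y * (a - b).im) := by
  rw [cauchyKernel_eq, norm_mul, Complex.norm_cpow_eq_rpow_re_of_pos (Real.cos_arctan_pos y),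
    Complex.norm_exp, Complex.re_ofReal_mul, Complex.mul_I_re, ← Complex.neg_im, neg_sub]

theorem norm_cauchyKernel_le (a b : ℂ) (y : ℝ) : ‖cauchyKernel a b y‖ ≤
    Real.cos (Real.arctan y) ^ (a + b).re * Real.exp (Real.pi / 2 * |(a - b).im|) := by
  rw [norm_cauchyKernel]
  refine mul_le_mul_of_nonneg_left (Real.exp_le_exp.2 ?_)
    (Real.rpow_nonneg (Real.cos_arctan_pos y).le _)
  refine (le_abs_self _).trans ?_
  rw [abs_mul]
  exact mul_le_mul_of_nonneg_right (abs_le.2 ⟨(Real.neg_pi_div_two_lt_arctan y).le,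
    (Real.arctan_lt_pi_div_two y).le⟩) (abs_nonneg _)

theorem continuous_cauchyKernel (a b : ℂ) : Continuous (cauchyKernel a b) := by
  have hlin : Continuous fun y : ℝ => (y : ℂ) * Complex.I :=
    Complex.continuous_ofReal.mul continuous_const
  exact ((continuous_const.add hlin).cpow continuous_const one_add_mul_I_mem_slitPlane).mul
    ((continuous_const.sub hlin).cpow continuous_const one_sub_mul_I_mem_slitPlane)

theorem integrable_cos_arctan_rpow {r : ℝ} (hr : 1 < r) :
    Integrable fun y : ℝ => Real.cos (Real.arctan y) ^ r := by
  have h := integrable_rpow_neg_one_add_norm_sq (E := ℝ) (μ := volume) (r := r) (by simpa)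
  refine h.congr (Eventually.of_forall fun y => ?_)
  have h0 : 0 ≤ 1 + y ^ 2 := by positivity
  simp only [Real.cos_arctan, Real.norm_eq_abs, sq_abs, one_div]
  rw [Real.inv_rpow (Real.sqrt_nonneg _), Real.sqrt_eq_rpow, ← Real.rpow_mul h0,
    ← Real.rpow_neg h0]
  congr 1
  ring

theorem integrable_cauchyKernel {a b : ℂ} (hab : 1 < (a + b).re) :
    Integrable (cauchyKernel a b) :=
  ((integrable_cos_arctan_rpow hab).mul_const _).mono'
    (continuous_cauchyKernel a b).aestronglyMeasurable
    (Eventually.of_forall (norm_cauchyKernel_le a b))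

theorem tendsto_cauchyKernel_cocompact {a b : ℂ} (hab : 0 < (a + b).re) :
    Tendsto (cauchyKernel a b) (cocompact ℝ) (𝓝 0) := by
  have hcos : Tendsto (fun y => Real.cos (Real.arctan y)) (cocompact ℝ) (𝓝 0) := by
    rw [cocompact_eq_atBot_atTop, tendsto_sup]
    constructor
    · have h := (Real.continuous_cos.tendsto _).comp
        (Real.tendsto_arctan_atBot.mono_right nhdsWithin_le_nhds)
      rwa [Real.cos_neg, Real.cos_pi_div_two] at h
    · have h := (Real.continuous_cos.tendsto _).comp
        (Real.tendsto_arctan_atTop.mono_right nhdsWithin_le_nhds)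
      rwa [Real.cos_pi_div_two] at h
  have hbound := (hcos.rpow_const (p := (a + b).re) (Or.inr hab.le)).mul_const
    (Real.exp (Real.pi / 2 * |(a - b).im|))
  rw [Real.zero_rpow hab.ne', zero_mul] at hbound
  exact squeeze_zero_norm (norm_cauchyKernel_le a b) hbound

theorem cauchyIntegral_comm (a b : ℂ) : cauchyIntegral a b = cauchyIntegral b a := by
  rw [cauchyIntegral, ← integral_neg_eq_self]
  exact integral_congr_ae (Eventually.of_forall fun y => by
    simp [cauchyKernel, mul_comm, sub_eq_add_neg])

theorem hasDerivAt_cauchyKernel (a b : ℂ) (y : ℝ) : HasDerivAt (cauchyKernel (a - 1) b)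
    (Complex.I * (2 * b * cauchyKernel a (b + 1) y - (a + b - 1) * cauchyKernel a b y)) y := by
  have hp := one_add_mul_I_mem_slitPlane y
  have hm := one_sub_mul_I_mem_slitPlane y
  have hlin : HasDerivAt (fun z : ℂ => z * Complex.I) Complex.I y := hasDerivAt_mul_const _
  have hadd : HasDerivAt (fun z : ℂ => 1 + z * Complex.I) Complex.I y := hlin.const_add 1
  have hsub : HasDerivAt (fun z : ℂ => 1 - z * Complex.I) (-Complex.I) y := hlin.const_sub 1
  have h := ((hadd.cpow_const (c := -(a - 1)) hp).mul
    (hsub.cpow_const (c := -b) hm)).comp_ofReal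
  have ep : (1 + y * Complex.I) ^ (-(a - 1)) =
      (1 + y * Complex.I) ^ (-a) * (1 + y * Complex.I) := by
    rw [neg_sub', sub_neg_eq_add, Complex.cpow_add _ _ (Complex.slitPlane_ne_zero hp),
      Complex.cpow_one]
  have em : (1 - y * Complex.I) ^ (-b) =
      (1 - y * Complex.I) ^ (-(b + 1)) * (1 - y * Complex.I) := by
    rw [show -b = -(b + 1) + 1 by ring, Complex.cpow_add _ _ (Complex.slitPlane_ne_zero hm),
      Complex.cpow_one]
  refine h.congr_deriv ?_
  simp only [cauchyKernel]
  rw [show -(a - 1) - 1 = -a by ring, show -b - 1 = -(b + 1) by ring, ep, em]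
  ring

theorem cauchyIntegral_add_one {a b : ℂ} (hab : 1 < (a + b).re) :
    (a + b - 1) * cauchyIntegral a b = 2 * b * cauchyIntegral a (b + 1) := by
  have hi := (integrable_cauchyKernel hab).const_mul (a + b - 1)
  have hi' := (integrable_cauchyKernel (a := a) (b := b + 1)
    (by rw [← add_assoc, Complex.add_re, Complex.one_re]; linarith)).const_mul (2 * b)
  have hlim : Tendsto (cauchyKernel (a - 1) b) (cocompact ℝ) (𝓝 0) :=
    tendsto_cauchyKernel_cocompact (by
      rw [sub_add_eq_add_sub, Complex.sub_re, Complex.one_re]; linarith)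
  have hzero := integral_of_hasDerivAt_of_tendsto (hasDerivAt_cauchyKernel a b)
    ((hi'.sub hi).const_mul Complex.I) (hlim.mono_left atBot_le_cocompact)
    (hlim.mono_left atTop_le_cocompact)
  rw [integral_const_mul, integral_sub hi' hi, integral_const_mul, integral_const_mul, sub_self,
    mul_eq_zero, or_iff_right Complex.I_ne_zero, sub_eq_zero] at hzero
  exact hzero.symm

/-- The function `t^{b-1} e^{-2πt}` on `t > 0`, extended by zero. Its Fourier transform is a
multiple of `(1 + i y)^{-b}`. -/
def gammaDensity (b : ℂ) : ℝ → ℂ :=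
  (Ioi 0).indicator fun t => (t : ℂ) ^ (b - 1) * Complex.exp (-((2 * Real.pi : ℝ) * t))

theorem integral_gammaDensity {b : ℂ} (hb : 0 < b.re) :
    ∫ t, gammaDensity b t = (1 / (2 * Real.pi : ℝ) : ℂ) ^ b * Complex.Gamma b := by
  simp only [gammaDensity]
  rw [integral_indicator measurableSet_Ioi,
    Complex.integral_cpow_mul_exp_neg_mul_Ioi hb Real.two_pi_pos]

theorem one_div_ofReal_cpow_ne_zero {r : ℝ} (hr : r ≠ 0) (b : ℂ) : (1 / r : ℂ) ^ b ≠ 0 :=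
  fun h => one_div_ne_zero (Complex.ofReal_ne_zero.2 hr) ((Complex.cpow_eq_zero_iff _ _).1 h).1

theorem integrable_gammaDensity {b : ℂ} (hb : 0 < b.re) : Integrable (gammaDensity b) :=
  .of_integral_ne_zero <| by
    rw [integral_gammaDensity hb]
    exact mul_ne_zero (one_div_ofReal_cpow_ne_zero Real.two_pi_pos.ne' b)
      (Complex.Gamma_ne_zero_of_re_pos hb)

theorem ofReal_mul_gammaDensity (b : ℂ) (t : ℝ) :
    (t : ℂ) * gammaDensity b t = gammaDensity (b + 1) t := by
  rcases le_or_gt t 0 with ht | ht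
  · simp [gammaDensity, indicator_of_notMem (notMem_Ioi.2 ht)]
  · have htc : (t : ℂ) ≠ 0 := Complex.ofReal_ne_zero.2 ht.ne'
    simp only [gammaDensity, indicator_of_mem (mem_Ioi.2 ht)]
    rw [← mul_assoc, add_sub_right_comm, Complex.cpow_add _ _ htc, Complex.cpow_one,
      mul_comm (t : ℂ)]

theorem fourier_gammaDensity_eq_integral_Ioi (b : ℂ) (y : ℝ) : 𝓕 (gammaDensity b) y =
    ∫ t in Ioi (0 : ℝ), (t : ℂ) ^ (b - 1) *
      Complex.exp (-(2 * Real.pi * (1 + y * Complex.I)) * t) := by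
  rw [Real.fourier_real_eq_integral_exp_smul, ← integral_indicator measurableSet_Ioi]
  refine integral_congr_ae (Eventually.of_forall fun t => ?_)
  by_cases ht : t ∈ Ioi (0 : ℝ)
  · simp only [gammaDensity, indicator_of_mem ht, smul_eq_mul]
    rw [mul_left_comm, ← Complex.exp_add]
    congr 2
    push_cast
    ring
  · simp [gammaDensity, indicator_of_notMem ht]

theorem integrableOn_cpow_mul_exp_Ioi {b : ℂ} (hb : 0 < b.re) (y : ℝ) :
    IntegrableOn (fun t : ℝ => (t : ℂ) ^ (b - 1) *
      Complex.exp (-(2 * Real.pi * (1 + y * Complex.I)) * t)) (Ioi 0) := by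
  have hphase : Continuous fun t : ℝ =>
      Complex.exp ((-2 * Real.pi * t * y : ℝ) * Complex.I) := by fun_prop
  have hi : Integrable fun t => Complex.exp ((-2 * Real.pi * t * y : ℝ) * Complex.I) *
      gammaDensity b t :=
    (integrable_gammaDensity hb).bdd_mul hphase.aestronglyMeasurable
      (Eventually.of_forall fun t => (Complex.norm_exp_ofReal_mul_I _).le)
  refine hi.integrableOn.congr_fun (fun t ht => ?_) measurableSet_Ioi
  simp only [gammaDensity, indicator_of_mem ht]
  rw [mul_left_comm, ← Complex.exp_add]
  congr 2
  push_cast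
  ring

theorem fourier_gammaDensity_add_one {b : ℂ} (hb : 0 < b.re) (y : ℝ) :
    2 * Real.pi * (1 + y * Complex.I) * 𝓕 (gammaDensity (b + 1)) y =
      b * 𝓕 (gammaDensity b) y := by
  set r : ℂ := 2 * Real.pi * (1 + y * Complex.I) with hr
  have hr_re : r.re = 2 * Real.pi := by simp [hr]
  have hb' : 0 < (b + 1).re := by simpa using by linarith
  have hi := (integrableOn_cpow_mul_exp_Ioi hb y).const_mul b
  have hi' := (integrableOn_cpow_mul_exp_Ioi hb' y).const_mul r
  have hderiv : ∀ t ∈ Ioi (0 : ℝ), HasDerivAt (fun t : ℝ => (t : ℂ) ^ b * Complex.exp (-r * t))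
      (b * ((t : ℂ) ^ (b - 1) * Complex.exp (-r * t)) -
        r * ((t : ℂ) ^ (b + 1 - 1) * Complex.exp (-r * t))) t := fun t ht => by
    have hexp : HasDerivAt (fun t : ℝ => Complex.exp (-r * t)) (Complex.exp (-r * t) * -r) t :=
      ((hasDerivAt_const_mul (-r)).cexp (x := (t : ℂ))).comp_ofReal
    refine ((hasDerivAt_ofReal_cpow_const (ne_of_gt ht)
      (Complex.ne_zero_of_re_pos hb)).mul hexp).congr_deriv ?_
    rw [add_sub_cancel_right]
    ring
  have hcont : Continuous fun t : ℝ => (t : ℂ) ^ b * Complex.exp (-r * t) :=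
    (Complex.continuous_ofReal_cpow_const hb).mul (by fun_prop)
  have hlim : Tendsto (fun t : ℝ => (t : ℂ) ^ b * Complex.exp (-r * t)) atTop (𝓝 0) := by
    rw [tendsto_zero_iff_norm_tendsto_zero]
    refine (tendsto_rpow_mul_exp_neg_mul_atTop_nhds_zero b.re _ Real.two_pi_pos).congr' ?_
    filter_upwards [eventually_gt_atTop 0] with t ht
    rw [norm_mul, Complex.norm_cpow_eq_rpow_re_of_pos ht, Complex.norm_exp, Complex.re_mul_ofReal,
      Complex.neg_re, hr_re]
  have hzero := integral_Ioi_of_hasDerivAt_of_tendsto hcont.continuousWithinAt hderiv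
    (hi.sub hi') hlim
  rw [integral_sub hi hi', integral_const_mul, integral_const_mul, Complex.ofReal_zero,
    Complex.zero_cpow (Complex.ne_zero_of_re_pos hb), zero_mul, sub_zero, sub_eq_zero] at hzero
  rw [fourier_gammaDensity_eq_integral_Ioi, fourier_gammaDensity_eq_integral_Ioi, ← hzero]

theorem hasDerivAt_fourier_gammaDensity {b : ℂ} (hb : 0 < b.re) (y : ℝ) :
    HasDerivAt (𝓕 (gammaDensity b))
      (-(2 * Real.pi * Complex.I) * 𝓕 (gammaDensity (b + 1)) y) y := by
  have hi : Integrable fun t : ℝ => t • gammaDensity b t := by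
    simp only [Complex.real_smul, ofReal_mul_gammaDensity]
    exact integrable_gammaDensity (by simpa using by linarith)
  refine (Real.hasDerivAt_fourier (integrable_gammaDensity hb) hi y).congr_deriv ?_
  simp only [Real.fourier_real_eq_integral_exp_smul, smul_eq_mul, ← integral_const_mul,
    ← ofReal_mul_gammaDensity b]
  exact integral_congr_ae (Eventually.of_forall fun t => by ring)

theorem fourier_gammaDensity {b : ℂ} (hb : 0 < b.re) (y : ℝ) : 𝓕 (gammaDensity b) y =
    (1 / (2 * Real.pi : ℝ) : ℂ) ^ b * Complex.Gamma b * cauchyKernel b 0 y := by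
  have hbase (y : ℝ) := one_add_mul_I_mem_slitPlane y
  have hderiv (y : ℝ) : HasDerivAt (fun y : ℝ => 𝓕 (gammaDensity b) y *
      (1 + y * Complex.I) ^ b) 0 y := by
    have hpow : HasDerivAt (fun y : ℝ => (1 + y * Complex.I) ^ b)
        (b * (1 + y * Complex.I) ^ (b - 1) * Complex.I) y :=
      (((hasDerivAt_mul_const Complex.I).const_add 1).cpow_const (hbase y)).comp_ofReal
    refine ((hasDerivAt_fourier_gammaDensity hb y).mul hpow).congr_deriv ?_
    rw [show b = b - 1 + 1 by ring, Complex.cpow_add _ _ (Complex.slitPlane_ne_zero (hbase y)),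
      Complex.cpow_one, sub_add_cancel]
    linear_combination (-Complex.I * (1 + y * Complex.I) ^ (b - 1)) *
      fourier_gammaDensity_add_one hb y
  have hconst := is_const_of_deriv_eq_zero (fun y => (hderiv y).differentiableAt)
    (fun y => (hderiv y).deriv) y 0
  have hzero : 𝓕 (gammaDensity b) 0 = ∫ t, gammaDensity b t := by
    simp [Real.fourier_real_eq_integral_exp_smul]
  rw [hzero, integral_gammaDensity hb, Complex.ofReal_zero, zero_mul, add_zero, Complex.one_cpow,
    mul_one] at hconst
  rw [cauchyKernel, neg_zero, Complex.cpow_zero, mul_one, Complex.cpow_neg, ← hconst,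
    mul_inv_cancel_right₀ (fun h => Complex.slitPlane_ne_zero (hbase y)
      ((Complex.cpow_eq_zero_iff _ _).1 h).1)]

theorem fourierInv_gammaDensity {b : ℂ} (hb : 0 < b.re) (y : ℝ) : 𝓕⁻ (gammaDensity b) y =
    (1 / (2 * Real.pi : ℝ) : ℂ) ^ b * Complex.Gamma b * cauchyKernel 0 b y := by
  rw [Real.fourierInv_eq_fourier_neg, fourier_gammaDensity hb]
  simp [cauchyKernel, sub_eq_add_neg]

theorem integral_gammaDensity_mul {a b : ℂ} (hab : 1 < (a + b).re) :
    ∫ t, gammaDensity a t * gammaDensity b t =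
      (1 / (2 * (2 * Real.pi) : ℝ) : ℂ) ^ (a + b - 1) * Complex.Gamma (a + b - 1) := by
  rw [← Complex.integral_cpow_mul_exp_neg_mul_Ioi
    (by rw [Complex.sub_re, Complex.one_re]; linarith) (mul_pos two_pos Real.two_pi_pos),
    ← integral_indicator measurableSet_Ioi]
  refine integral_congr_ae (Eventually.of_forall fun t => ?_)
  by_cases ht : t ∈ Ioi (0 : ℝ)
  · simp only [gammaDensity, indicator_of_mem ht]
    rw [mul_mul_mul_comm, ← Complex.exp_add,
      ← Complex.cpow_add _ _ (Complex.ofReal_ne_zero.2 (ne_of_gt ht))]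
    congr 2 <;> push_cast <;> ring
  · simp [gammaDensity, indicator_of_notMem ht]

theorem continuous_gammaDensity {b : ℂ} (hb : 1 < b.re) : Continuous (gammaDensity b) := by
  have hb' : 0 < (b - 1).re := by rw [Complex.sub_re, Complex.one_re]; linarith
  refine Continuous.indicator (fun t ht => ?_)
    ((Complex.continuous_ofReal_cpow_const hb').mul (by fun_prop))
  rw [frontier_Ioi, mem_singleton_iff] at ht
  rw [ht, Complex.ofReal_zero, Complex.zero_cpow (Complex.ne_zero_of_re_pos hb'), zero_mul]

theorem integral_fourier_mul_fourierInv_gammaDensity {a b : ℂ} (ha : 0 < a.re) (hb : 1 < b.re) :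
    ∫ y, 𝓕 (gammaDensity a) y * 𝓕⁻ (gammaDensity b) y =
      ∫ t, gammaDensity a t * gammaDensity b t := by
  have hb0 := zero_lt_one.trans hb
  have hinv : Integrable (𝓕⁻ (gammaDensity b)) := by
    simp only [funext (fourierInv_gammaDensity hb0)]
    exact (integrable_cauchyKernel (by rwa [zero_add])).const_mul _
  have hfourier : Integrable (𝓕 (gammaDensity b)) := by
    simp only [funext (fourier_gammaDensity hb0)]
    exact (integrable_cauchyKernel (by rwa [add_zero])).const_mul _
  calc ∫ y, 𝓕 (gammaDensity a) y * 𝓕⁻ (gammaDensity b) y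
      = ∫ t, gammaDensity a t * 𝓕 (𝓕⁻ (gammaDensity b)) t := by
        simpa using! VectorFourier.integral_fourierIntegral_smul_eq_flip (L := innerₗ ℝ)
          Real.continuous_fourierChar continuous_inner (integrable_gammaDensity ha) hinv
    _ = ∫ t, gammaDensity a t * gammaDensity b t := by
        rw [(continuous_gammaDensity hb).fourier_fourierInv_eq (integrable_gammaDensity hb0)
          hfourier]

theorem one_div_two_mul_cpow {r : ℝ} (hr : 0 < r) (s : ℂ) :
    (1 / (2 * r : ℝ) : ℂ) ^ (s - 1) = r * 2 ^ (1 - s) * (1 / r : ℂ) ^ s := by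
  have hr' : (1 / r : ℂ) ≠ 0 := one_div_ne_zero (Complex.ofReal_ne_zero.2 hr.ne')
  have htwo : ((1 / 2 : ℝ) : ℂ) ^ (s - 1) = 2 ^ (1 - s) := by
    rw [one_div, Complex.ofReal_inv, Complex.ofReal_ofNat, Complex.inv_cpow _ _
      (by simp [Real.pi_ne_zero.symm]), ← Complex.cpow_neg, neg_sub]
  rw [show (1 / (2 * r : ℝ) : ℂ) = ((1 / 2 : ℝ) : ℂ) * ((1 / r : ℝ) : ℂ) by push_cast; ring,
    Complex.mul_cpow_ofReal_nonneg one_half_pos.le (one_div_pos.2 hr).le, htwo,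
    Complex.ofReal_div, Complex.ofReal_one, Complex.cpow_sub _ _ hr', Complex.cpow_one]
  field_simp

theorem cauchyIntegral_eq_of_one_lt_re {a b : ℂ} (ha : 0 < a.re) (hb : 1 < b.re) :
    cauchyIntegral a b = Real.pi * 2 ^ (2 - a - b) * Complex.Gamma (a + b - 1) *
      ((Complex.Gamma a)⁻¹ * (Complex.Gamma b)⁻¹) := by
  have hb0 := zero_lt_one.trans hb
  have hpi : (1 / (2 * Real.pi : ℝ) : ℂ) ≠ 0 :=
    one_div_ne_zero (Complex.ofReal_ne_zero.2 Real.two_pi_pos.ne')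
  have key : (1 / (2 * Real.pi : ℝ) : ℂ) ^ (a + b) * (Complex.Gamma a * Complex.Gamma b) *
      cauchyIntegral a b =
        (1 / (2 * (2 * Real.pi) : ℝ) : ℂ) ^ (a + b - 1) * Complex.Gamma (a + b - 1) := by
    rw [← integral_gammaDensity_mul (by rw [Complex.add_re]; linarith),
      ← integral_fourier_mul_fourierInv_gammaDensity ha hb, cauchyIntegral, ← integral_const_mul]
    refine integral_congr_ae (Eventually.of_forall fun y => ?_)
    simp only [fourier_gammaDensity ha, fourierInv_gammaDensity hb0, cauchyKernel,
      Complex.cpow_add _ _ hpi, neg_zero, Complex.cpow_zero]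
    ring
  rw [one_div_two_mul_cpow Real.two_pi_pos] at key
  have hΓ := mul_ne_zero (Complex.Gamma_ne_zero_of_re_pos ha) (Complex.Gamma_ne_zero_of_re_pos hb0)
  refine mul_left_cancel₀ (mul_ne_zero
    (one_div_ofReal_cpow_ne_zero Real.two_pi_pos.ne' (a + b)) hΓ) ?_
  have hpow : (2 : ℂ) ^ (2 - a - b) = 2 * 2 ^ (1 - (a + b)) := by
    rw [show 2 - a - b = 1 + (1 - (a + b)) by ring, Complex.cpow_add _ _ two_ne_zero,
      Complex.cpow_one]
  rw [key, hpow, ← mul_inv, mul_assoc (_ ^ (a + b)), mul_comm _ (_ * _)⁻¹,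
    mul_inv_cancel_left₀ hΓ]
  push_cast
  ring

theorem cauchyIntegral_eq_of_re_pos {a : ℂ} (ha : 0 < a.re) (n : ℕ) {b : ℂ}
    (hb : 1 < b.re + n) (hab : 1 < (a + b).re) :
    cauchyIntegral a b = Real.pi * 2 ^ (2 - a - b) * Complex.Gamma (a + b - 1) *
      ((Complex.Gamma a)⁻¹ * (Complex.Gamma b)⁻¹) := by
  induction n generalizing b with
  | zero => exact cauchyIntegral_eq_of_one_lt_re ha (by simpa using hb)
  | succ n ih =>
    have hne : a + b - 1 ≠ 0 := Complex.ne_zero_of_re_pos (by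
      rw [Complex.sub_re, Complex.one_re]; linarith)
    have hΓ := Complex.Gamma_add_one _ hne
    have hpow : (2 : ℂ) ^ (2 - a - b) = 2 * 2 ^ (2 - a - (b + 1)) := by
      rw [show 2 - a - b = 1 + (2 - a - (b + 1)) by ring, Complex.cpow_add _ _ two_ne_zero,
        Complex.cpow_one]
    refine mul_left_cancel₀ hne ?_
    rw [cauchyIntegral_add_one hab, ih (by push_cast at hb; simpa using by linarith)
      (by rw [← add_assoc, Complex.add_re, Complex.one_re]; linarith),
      Complex.one_div_Gamma_eq_self_mul_one_div_Gamma_add_one b, hpow,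
      show a + (b + 1) - 1 = a + b - 1 + 1 by ring, hΓ]
    ring

theorem cauchyIntegral_eq {a b : ℂ} (hab : 1 < (a + b).re) :
    cauchyIntegral a b = Real.pi * 2 ^ (2 - a - b) * Complex.Gamma (a + b - 1) *
      ((Complex.Gamma a)⁻¹ * (Complex.Gamma b)⁻¹) := by
  have hre : 1 < a.re + b.re := by rwa [← Complex.add_re]
  rcases lt_or_ge 0 a.re with ha | ha
  · obtain ⟨n, hn⟩ := exists_nat_gt (1 - b.re)
    exact cauchyIntegral_eq_of_re_pos ha n (by linarith) hab
  · rw [cauchyIntegral_comm, cauchyIntegral_eq_of_re_pos (a := b) (by linarith)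
      (⌈1 - a.re⌉₊ + 1) (by push_cast; linarith [Nat.le_ceil (1 - a.re)]) (by rwa [add_comm]),
      sub_right_comm, add_comm b a, mul_comm (Complex.Gamma b)⁻¹]

/-- The function `π 2^{1-μ} / (Γ((1+μ+l)/2) Γ((1+μ-l)/2))`, entire in `μ`: its product with `Γ(μ)`
continues the beta integral `∫ cos(arctan y)^{μ+1} exp(-i l arctan y) dy` to all `μ`. -/
def cauchyEntire (μ : ℂ) (l : ℝ) : ℂ := Real.pi * 2 ^ (1 - μ) *
  ((Complex.Gamma ((1 + μ + l) / 2))⁻¹ * (Complex.Gamma ((1 + μ - l) / 2))⁻¹)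

theorem cauchyKernel_half_add_half_sub (μ : ℂ) (l y : ℝ) :
    cauchyKernel ((1 + μ + l) / 2) ((1 + μ - l) / 2) y = (Real.cos (Real.arctan y) : ℂ) ^ (μ + 1) *
      Complex.exp ((l * -Real.arctan y : ℝ) * Complex.I) := by
  rw [cauchyKernel_eq]
  congr 2 <;> push_cast <;> ring

theorem one_lt_re_half_add_half_sub {μ : ℂ} (hμ : 0 < μ.re) (l : ℝ) :
    1 < ((1 + μ + l) / 2 + (1 + μ - l) / 2).re := by
  rw [show (1 + μ + l) / 2 + (1 + μ - l) / 2 = 1 + μ by ring, Complex.add_re, Complex.one_re]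
  linarith

theorem cauchyIntegral_half_add_half_sub {μ : ℂ} (hμ : 0 < μ.re) (l : ℝ) :
    cauchyIntegral ((1 + μ + l) / 2) ((1 + μ - l) / 2) = Complex.Gamma μ * cauchyEntire μ l := by
  rw [cauchyIntegral_eq (one_lt_re_half_add_half_sub hμ l), cauchyEntire,
    show 2 - (1 + μ + l) / 2 - (1 + μ - l) / 2 = 1 - μ by ring,
    show (1 + μ + l) / 2 + (1 + μ - l) / 2 - 1 = μ by ring]
  ring

theorem cauchyEntire_neg (μ : ℂ) (l : ℝ) : cauchyEntire μ (-l) = cauchyEntire μ l := by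
  rw [cauchyEntire, cauchyEntire, mul_comm (Complex.Gamma ((1 + μ + l) / 2))⁻¹, Complex.ofReal_neg,
    ← sub_eq_add_neg, sub_neg_eq_add]

theorem differentiable_cauchyEntire (l : ℝ) : Differentiable ℂ fun μ => cauchyEntire μ l := by
  have hpow : Differentiable ℂ fun μ : ℂ => (2 : ℂ) ^ (1 - μ) :=
    ((differentiable_const 1).sub differentiable_id).const_cpow (Or.inl two_ne_zero)
  exact (hpow.const_mul _).mul
    ((Complex.differentiable_one_div_Gamma.comp (by fun_prop)).mul
      (Complex.differentiable_one_div_Gamma.comp (by fun_prop)))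

theorem cauchyEntire_add_two (μ : ℂ) (l : ℝ) :
    cauchyEntire μ l = ((μ + 1) ^ 2 - l ^ 2) * cauchyEntire (μ + 2) l := by
  have hpow : (2 : ℂ) ^ (1 - μ) = 4 * 2 ^ (1 - (μ + 2)) := by
    rw [show (1 - μ) = (1 - (μ + 2)) + (2 : ℕ) by push_cast; ring,
      Complex.cpow_add _ _ two_ne_zero, Complex.cpow_natCast]
    norm_num; ring
  rw [cauchyEntire, cauchyEntire, hpow,
    Complex.one_div_Gamma_eq_self_mul_one_div_Gamma_add_one ((1 + μ + l) / 2),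
    Complex.one_div_Gamma_eq_self_mul_one_div_Gamma_add_one ((1 + μ - l) / 2),
    show (1 + (μ + 2) + l) / 2 = (1 + μ + l) / 2 + 1 by ring,
    show (1 + (μ + 2) - l) / 2 = (1 + μ - l) / 2 + 1 by ring]
  ring

theorem norm_cauchyIntegral_le {a b : ℂ} {r : ℝ} (hr : 1 < r) (hab : r ≤ (a + b).re)
    (him : (a - b).im = 0) : ‖cauchyIntegral a b‖ ≤ ∫ y, Real.cos (Real.arctan y) ^ r := by
  refine norm_integral_le_of_norm_le (integrable_cos_arctan_rpow hr)
    (Eventually.of_forall fun y => ?_)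
  rw [norm_cauchyKernel, him, mul_zero, Real.exp_zero, mul_one]
  exact Real.rpow_le_rpow_of_exponent_ge (Real.cos_arctan_pos y) (Real.cos_le_one _) hab

theorem exists_norm_cauchyEntire_le_of_one_le_re (R : ℝ) : ∃ C : ℝ, 0 ≤ C ∧
    ∀ μ : ℂ, ‖μ‖ ≤ R → 1 ≤ μ.re → ∀ l : ℝ, ‖cauchyEntire μ l‖ ≤ C := by
  obtain ⟨C, hC⟩ := (isCompact_closedBall (0 : ℂ) R).exists_bound_of_continuousOn
    Complex.differentiable_one_div_Gamma.continuous.continuousOn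
  refine ⟨|C| * ∫ y, Real.cos (Real.arctan y) ^ (2 : ℝ), mul_nonneg (abs_nonneg C)
    (integral_nonneg fun y => Real.rpow_nonneg (Real.cos_arctan_pos y).le _),
    fun μ hμ hre l => ?_⟩
  have hpos : 0 < μ.re := one_pos.trans_le hre
  have hE : cauchyEntire μ l =
      (Complex.Gamma μ)⁻¹ * cauchyIntegral ((1 + μ + l) / 2) ((1 + μ - l) / 2) := by
    rw [cauchyIntegral_half_add_half_sub hpos,
      inv_mul_cancel_left₀ (Complex.Gamma_ne_zero_of_re_pos hpos)]
  rw [hE, norm_mul]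
  refine mul_le_mul ((hC μ (by simpa using hμ)).trans (le_abs_self C))
    (norm_cauchyIntegral_le one_lt_two ?_ ?_) (norm_nonneg _) (abs_nonneg C)
  · rw [show (1 + μ + l) / 2 + (1 + μ - l) / 2 = 1 + μ by ring, Complex.add_re, Complex.one_re]
    linarith
  · rw [show (1 + μ + l) / 2 - (1 + μ - l) / 2 = l by ring, Complex.ofReal_im]

theorem exists_norm_cauchyEntire_le (k : ℕ) (R : ℝ) : ∃ C : ℝ, 0 ≤ C ∧
    ∀ μ : ℂ, ‖μ‖ ≤ R → 1 - 2 * (k : ℝ) ≤ μ.re → ∀ l : ℝ,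
      ‖cauchyEntire μ l‖ ≤ C * (1 + l ^ 2) ^ k := by
  induction k generalizing R with
  | zero => simpa using exists_norm_cauchyEntire_le_of_one_le_re R
  | succ k ih =>
    obtain ⟨C, hC0, hC⟩ := ih (R + 2)
    refine ⟨((R + 1) ^ 2 + 1) * C, by positivity, fun μ hμ hre l => ?_⟩
    have hshift := hC (μ + 2) ((norm_add_le _ _).trans (by simpa using hμ))
      (by push_cast at hre; simp; linarith) l
    have hfactor : ‖(μ + 1) ^ 2 - (l : ℂ) ^ 2‖ ≤ ((R + 1) ^ 2 + 1) * (1 + l ^ 2) := by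
      have hμ1 : ‖(μ + 1) ^ 2‖ ≤ (R + 1) ^ 2 := by
        rw [norm_pow]
        exact pow_le_pow_left₀ (norm_nonneg _) ((norm_add_le _ _).trans (by simpa using hμ)) 2
      have hl : ‖(l : ℂ) ^ 2‖ = l ^ 2 := by
        rw [norm_pow, Complex.norm_real, Real.norm_eq_abs, sq_abs]
      have hcross : 0 ≤ (R + 1) ^ 2 * l ^ 2 := by positivity
      linarith [norm_sub_le ((μ + 1) ^ 2) ((l : ℂ) ^ 2)]
    rw [cauchyEntire_add_two, norm_mul]
    calc _ ≤ ((R + 1) ^ 2 + 1) * (1 + l ^ 2) * (C * (1 + l ^ 2) ^ k) :=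
          mul_le_mul hfactor hshift (norm_nonneg _) (by positivity)
      _ = _ := by ring

theorem one_add_kExponent_sq_le (ε : ℤˣ) (n : ℤ) :
    1 + kExponent ε n ^ 2 ≤ 8 * (1 + (n : ℝ) ^ 2) := by
  have hε : ((ε : ℤ) : ℝ) ^ 2 = 1 := by rcases Int.units_eq_one_or ε with rfl | rfl <;> simp
  rw [kExponent]
  nlinarith [sq_nonneg (2 * (n : ℝ) + ((ε : ℤ) : ℝ) / 2)]

theorem one_add_kExponent_sq_pow_le (ε : ℤˣ) (n : ℤ) (k : ℕ) :
    (1 + kExponent ε n ^ 2) ^ k ≤ 8 ^ k * (1 + (n : ℝ) ^ 2) ^ k := by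
  rw [← mul_pow]
  exact pow_le_pow_left₀ (by positivity) (one_add_kExponent_sq_le ε n) k

theorem exists_norm_cauchyEntire_kExponent_le (ε : ℤˣ) (k : ℕ) (R : ℝ) : ∃ C : ℝ, 0 ≤ C ∧
    ∀ μ : ℂ, ‖μ‖ ≤ R → 1 - 2 * (k : ℝ) ≤ μ.re → ∀ n : ℤ,
      ‖cauchyEntire μ (kExponent ε n)‖ ≤ C * (1 + (n : ℝ) ^ 2) ^ k := by
  obtain ⟨C, hC0, hC⟩ := exists_norm_cauchyEntire_le k R
  refine ⟨C * 8 ^ k, by positivity, fun μ hμ hre n => (hC μ hμ hre _).trans ?_⟩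
  rw [mul_assoc]
  exact mul_le_mul_of_nonneg_left (one_add_kExponent_sq_pow_le ε n k) hC0

/-! ### Fourier series of smooth periodic functions -/

/-- Rapidly decreasing sequences indexed by `ℤ`: the Fourier coefficients of smooth periodic
functions. -/
def RapidDecay (b : ℤ → ℂ) : Prop := ∀ k : ℕ, ∃ C : ℝ, ∀ n : ℤ, ‖b n‖ * (1 + (n : ℝ) ^ 2) ^ k ≤ C

theorem summable_inv_one_add_int_sq : Summable fun n : ℤ => (1 + (n : ℝ) ^ 2)⁻¹ := by
  refine ((Real.summable_one_div_int_pow (p := 2)).2 one_lt_two).of_norm_bounded_eventually ?_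
  filter_upwards [(Set.finite_singleton (0 : ℤ)).compl_mem_cofinite] with n hn
  have hn0 : (n : ℝ) ≠ 0 := by exact_mod_cast hn
  rw [Real.norm_of_nonneg (by positivity), one_div]
  exact inv_anti₀ (by positivity) (by linarith)

namespace RapidDecay

variable {b : ℤ → ℂ} (hb : RapidDecay b)
include hb

theorem exists_norm_mul_pow_le (k : ℕ) : ∃ C : ℝ, 0 ≤ C ∧
    ∀ n : ℤ, ‖b n‖ * (1 + (n : ℝ) ^ 2) ^ k ≤ C * (1 + (n : ℝ) ^ 2)⁻¹ := by
  obtain ⟨C, hC⟩ := hb (k + 1)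
  refine ⟨C, (by positivity : 0 ≤ ‖b 0‖ * (1 + ((0 : ℤ) : ℝ) ^ 2) ^ (k + 1)).trans (hC 0),
    fun n => ?_⟩
  rw [← div_eq_mul_inv, le_div_iff₀ (by positivity), mul_assoc, ← pow_succ]
  exact hC n

theorem summable_norm : Summable fun n => ‖b n‖ := by
  obtain ⟨C, -, hC⟩ := hb.exists_norm_mul_pow_le 0
  exact (summable_inv_one_add_int_sq.mul_left C).of_nonneg_of_le (fun n => norm_nonneg _)
    fun n => by simpa using hC n

theorem mul {a : ℤ → ℂ} {C : ℝ} {k : ℕ} (ha : ∀ n : ℤ, ‖a n‖ ≤ C * (1 + (n : ℝ) ^ 2) ^ k) :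
    RapidDecay fun n => b n * a n := by
  intro j
  obtain ⟨D, hD⟩ := hb (k + j)
  have hC : 0 ≤ C := by simpa using (norm_nonneg _).trans (ha 0)
  refine ⟨C * D, fun n => ?_⟩
  calc ‖b n * a n‖ * (1 + (n : ℝ) ^ 2) ^ j
      ≤ ‖b n‖ * (C * (1 + (n : ℝ) ^ 2) ^ k) * (1 + (n : ℝ) ^ 2) ^ j := by
        rw [norm_mul]; gcongr; exact ha n
    _ = C * (‖b n‖ * (1 + (n : ℝ) ^ 2) ^ (k + j)) := by rw [pow_add]; ring
    _ ≤ C * D := by gcongr; exact hD n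

end RapidDecay

theorem rapidDecay_single (m : ℤ) (c : ℂ) : RapidDecay (Pi.single m c) := by
  intro k
  refine ⟨‖c‖ * (1 + (m : ℝ) ^ 2) ^ k, fun n => ?_⟩
  rcases eq_or_ne n m with rfl | h
  · rw [Pi.single_eq_same]
  · rw [Pi.single_eq_of_ne h, norm_zero, zero_mul]; positivity

theorem norm_fourierCoeffOn_le {a b : ℝ} (hab : a < b) {p : ℝ → ℂ} {M : ℝ}
    (hM : ∀ x ∈ Icc a b, ‖p x‖ ≤ M) (n : ℤ) : ‖fourierCoeffOn hab p n‖ ≤ M := by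
  have hba : 0 < b - a := sub_pos.2 hab
  have h := intervalIntegral.norm_integral_le_of_norm_le_const (a := a) (b := b) (C := M)
    (f := fun x => fourier (-n) (x : AddCircle (b - a)) • p x) fun x hx => by
      rw [uIoc_of_le hab.le] at hx
      rw [norm_smul, fourier_apply, Circle.norm_coe, one_mul]
      exact hM x ⟨hx.1.le, hx.2⟩
  rw [abs_of_pos hba] at h
  rw [fourierCoeffOn_eq_integral, norm_smul, Real.norm_of_nonneg (by positivity), one_div,
    inv_mul_le_iff₀ hba, mul_comm]
  exact h

theorem periodic_deriv {p : ℝ → ℂ} {T : ℝ} (hper : Function.Periodic p T) :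
    Function.Periodic (deriv p) T := fun x => by
  rw [← deriv_comp_add_const, funext hper]

section PeriodicFunction

variable {T : ℝ} (hT : 0 < T)

theorem fourierCoeffOn_eq_mul_deriv_of_periodic {p : ℝ → ℂ} (hp : ContDiff ℝ 1 p)
    (hper : Function.Periodic p T) {n : ℤ} (hn : n ≠ 0) :
    fourierCoeffOn hT p n =
      T / (2 * Real.pi * Complex.I * n) * fourierCoeffOn hT (deriv p) n := by
  have hp' : Differentiable ℝ p := hp.differentiable one_ne_zero
  rw [fourierCoeffOn_of_hasDerivAt hT hn (fun θ _ => (hp' θ).hasDerivAt)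
    ((hp.continuous_deriv le_rfl).intervalIntegrable _ _), hper.eq, sub_self, mul_zero, zero_sub]
  push_cast
  ring

theorem norm_fourierCoeffOn_mul_sq_le_of_periodic {p : ℝ → ℂ} (hp : ContDiff ℝ 2 p)
    (hper : Function.Periodic p T) (n : ℤ) :
    ‖fourierCoeffOn hT p n‖ * (n : ℝ) ^ 2 ≤
      (T / (2 * Real.pi)) ^ 2 * ‖fourierCoeffOn hT (deriv (deriv p)) n‖ := by
  rcases eq_or_ne n 0 with rfl | hn
  · rw [Int.cast_zero, zero_pow two_ne_zero, mul_zero]; positivity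
  · have hn' : (n : ℝ) ≠ 0 := by exact_mod_cast hn
    have hderiv : ContDiff ℝ 1 (deriv p) := hp.deriv'
    rw [fourierCoeffOn_eq_mul_deriv_of_periodic hT (hp.of_le one_le_two) hper hn,
      fourierCoeffOn_eq_mul_deriv_of_periodic hT hderiv (periodic_deriv hper) hn]
    simp only [norm_mul, norm_div, Complex.norm_I, Complex.norm_real, Complex.norm_intCast,
      Complex.norm_ofNat, Real.norm_of_nonneg hT.le, Real.norm_of_nonneg Real.pi_pos.le, mul_one]
    rw [← sq_abs (n : ℝ)]
    have habs : |(n : ℝ)| ≠ 0 := abs_ne_zero.2 hn'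
    refine le_of_eq ?_
    field_simp

theorem rapidDecay_fourierCoeffOn {p : ℝ → ℂ} (hp : ContDiff ℝ ∞ p)
    (hper : Function.Periodic p T) : RapidDecay (fourierCoeffOn hT p) := by
  intro k
  induction k generalizing p with
  | zero =>
    obtain ⟨M, hM⟩ := isCompact_Icc.exists_bound_of_continuousOn (s := Icc 0 T)
      hp.continuous.continuousOn
    exact ⟨M, fun n => by simpa using norm_fourierCoeffOn_le hT hM n⟩
  | succ k ih =>
    obtain ⟨C, hC⟩ := ih hp hper
    obtain ⟨D, hD⟩ := ih (contDiff_infty_iff_deriv.1 (contDiff_infty_iff_deriv.1 hp).2).2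
      (periodic_deriv (periodic_deriv hper))
    refine ⟨C + (T / (2 * Real.pi)) ^ 2 * D, fun n => ?_⟩
    have hsq := norm_fourierCoeffOn_mul_sq_le_of_periodic hT (contDiff_infty.1 hp 2) hper n
    calc ‖fourierCoeffOn hT p n‖ * (1 + (n : ℝ) ^ 2) ^ (k + 1)
        = ‖fourierCoeffOn hT p n‖ * (1 + (n : ℝ) ^ 2) ^ k +
            ‖fourierCoeffOn hT p n‖ * (n : ℝ) ^ 2 * (1 + (n : ℝ) ^ 2) ^ k := by ring
      _ ≤ C + (T / (2 * Real.pi)) ^ 2 * D := by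
          refine add_le_add (hC n) ((mul_le_mul_of_nonneg_right hsq (by positivity)).trans ?_)
          rw [mul_assoc]
          exact mul_le_mul_of_nonneg_left (hD n) (sq_nonneg _)

theorem hasSum_fourierCoeffOn {p : ℝ → ℂ} (hp : ContDiff ℝ ∞ p) (hper : Function.Periodic p T)
    (θ : ℝ) : HasSum (fun n : ℤ => fourierCoeffOn hT p n * fourier n (θ : AddCircle T)) (p θ) := by
  have : Fact (0 < T) := ⟨hT⟩
  let P : C(AddCircle T, ℂ) := ⟨hper.lift, continuous_coinduced_dom.mpr hp.continuous⟩
  have hcoeff : fourierCoeff P = fourierCoeffOn hT p := funext fun n => by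
    rw [fourierCoeff_eq_intervalIntegral _ _ 0, fourierCoeffOn_eq_integral, zero_add, sub_zero]
    rfl
  have hsum : Summable (fourierCoeff P) := by
    rw [hcoeff]
    exact (rapidDecay_fourierCoeffOn hT hp hper).summable_norm.of_norm
  simpa only [hcoeff, smul_eq_mul] using!
    has_pointwise_sum_fourier_series_of_summable hsum (θ : AddCircle T)

end PeriodicFunction

/-! ### Expansion into characters of `K̃` -/

theorem norm_kCharacter (ε : ℤˣ) (n : ℤ) (θ : ℝ) : ‖kCharacter ε n θ‖ = 1 :=
  Complex.norm_exp_ofReal_mul_I _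

theorem fourier_mul_kCharacter_zero (ε : ℤˣ) (n : ℤ) (θ : ℝ) :
    fourier n (θ : AddCircle Real.pi) * kCharacter ε 0 θ = kCharacter ε n θ := by
  have hpi : (Real.pi : ℂ) ≠ 0 := by exact_mod_cast Real.pi_ne_zero
  rw [fourier_coe_apply, kCharacter, kCharacter, ← Complex.exp_add, kExponent, kExponent]
  congr 1
  push_cast
  field_simp
  ring

theorem IsKEquivariant.periodic_div_kCharacter {ε : ℤˣ} {h : ℝ → ℂ} (hh : IsKEquivariant ε h)
    (n : ℤ) : Function.Periodic (fun θ => h θ / kCharacter ε n θ) Real.pi := fun θ => by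
  have hc : -(((ε : ℤ) : ℂ) * Complex.I) ≠ 0 := by
    rw [← kCharacter_pi ε n]; exact Complex.exp_ne_zero _
  simp only [hh θ, isKEquivariant_kCharacter ε n θ, mul_div_mul_left _ _ hc]

theorem IsKEquivariant.exists_rapidDecay_hasSum {ε : ℤˣ} {h : ℝ → ℂ} (hh : IsKEquivariant ε h)
    (hsmooth : ContDiff ℝ ∞ h) :
    ∃ b : ℤ → ℂ, RapidDecay b ∧ ∀ θ, HasSum (fun n => b n * kCharacter ε n θ) (h θ) := by
  have hχ (θ : ℝ) : kCharacter ε 0 θ ≠ 0 := Complex.exp_ne_zero _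
  have hp : ContDiff ℝ ∞ fun θ => h θ / kCharacter ε 0 θ := by
    simpa only [div_eq_mul_inv] using! hsmooth.mul ((contDiff_kCharacter ε 0).inv hχ)
  have hper := hh.periodic_div_kCharacter 0
  refine ⟨_, rapidDecay_fourierCoeffOn Real.pi_pos hp hper, fun θ => ?_⟩
  simpa only [mul_assoc, fourier_mul_kCharacter_zero, div_mul_cancel₀ _ (hχ θ)] using
    (hasSum_fourierCoeffOn Real.pi_pos hp hper θ).mul_right (kCharacter ε 0 θ)

theorem iteratedDeriv_kCharacter (ε : ℤˣ) (n : ℤ) (k : ℕ) : iteratedDeriv k (kCharacter ε n) =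
    fun θ => (kExponent ε n * Complex.I) ^ k * kCharacter ε n θ := by
  induction k with
  | zero => ext; simp
  | succ k ih =>
    ext θ
    have hderiv : HasDerivAt (kCharacter ε n)
        (kCharacter ε n θ * ((kExponent ε n * 1 : ℝ) * Complex.I)) θ :=
      (((hasDerivAt_id θ).const_mul (kExponent ε n)).ofReal_comp.mul_const Complex.I).cexp
    rw [iteratedDeriv_succ, ih, (hderiv.const_mul _).deriv]
    push_cast
    ring

theorem norm_iteratedDeriv_kCharacter_le (ε : ℤˣ) (n : ℤ) (k : ℕ) (θ : ℝ) :
    ‖iteratedDeriv k (kCharacter ε n) θ‖ ≤ 8 ^ k * (1 + (n : ℝ) ^ 2) ^ k := by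
  have habs : |kExponent ε n| ≤ 1 + kExponent ε n ^ 2 := by
    rw [← sq_abs]; nlinarith [sq_nonneg (|kExponent ε n| - 1)]
  rw [iteratedDeriv_kCharacter, norm_mul, norm_kCharacter, mul_one, norm_pow, norm_mul,
    Complex.norm_I, mul_one, Complex.norm_real, Real.norm_eq_abs]
  exact (pow_le_pow_left₀ (abs_nonneg _) habs k).trans (one_add_kExponent_sq_pow_le ε n k)

theorem RapidDecay.contDiff_tsum {b : ℤ → ℂ} (hb : RapidDecay b) (ε : ℤˣ) :
    ContDiff ℝ ∞ fun θ => ∑' n, b n * kCharacter ε n θ := by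
  choose C _ hC using fun k => hb.exists_norm_mul_pow_le k
  refine _root_.contDiff_tsum (N := ⊤)
    (v := fun k (n : ℤ) => 8 ^ k * (C k * (1 + (n : ℝ) ^ 2)⁻¹)) (fun n => contDiff_const.mul
      (contDiff_kCharacter ε n)) (fun k _ => (summable_inv_one_add_int_sq.mul_left _).mul_left _)
    fun k n θ _ => ?_
  rw [norm_iteratedFDeriv_eq_norm_iteratedDeriv, iteratedDeriv_const_mul_field, norm_mul]
  calc ‖b n‖ * ‖iteratedDeriv k (kCharacter ε n) θ‖
      ≤ ‖b n‖ * (8 ^ k * (1 + (n : ℝ) ^ 2) ^ k) := by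
        gcongr; exact norm_iteratedDeriv_kCharacter_le ε n k θ
    _ = 8 ^ k * (‖b n‖ * (1 + (n : ℝ) ^ 2) ^ k) := by ring
    _ ≤ _ := mul_le_mul_of_nonneg_left (hC k n) (by positivity)

/-! ### Meromorphic continuation of the intertwining integrals -/

theorem eq_of_meromorphicNFOn_univ {𝕜 E : Type*} [NontriviallyNormedField 𝕜] [PreconnectedSpace 𝕜]
    [NormedAddCommGroup E] [NormedSpace 𝕜 E] {F G : 𝕜 → E} (hF : MeromorphicNFOn F univ)
    (hG : MeromorphicNFOn G univ) {z₀ : 𝕜} (h : F =ᶠ[𝓝[≠] z₀] G) : F = G := by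
  have hsub : MeromorphicOn (F - G) univ := hF.meromorphicOn.sub hG.meromorphicOn
  have hz₀ : meromorphicOrderAt (F - G) z₀ = ⊤ :=
    meromorphicOrderAt_eq_top_iff.2 (h.mono fun z hz => sub_eq_zero.2 hz)
  ext z
  have hz : meromorphicOrderAt (F - G) z = ⊤ := by
    by_contra hne
    exact hsub.meromorphicOrderAt_ne_top_of_isPreconnected isPreconnected_univ (mem_univ z)
      (mem_univ z₀) hne hz₀
  have hFG : F =ᶠ[𝓝[≠] z] G :=
    (meromorphicOrderAt_eq_top_iff.1 hz).mono fun w hw => sub_eq_zero.1 hw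
  exact (((hF (mem_univ z)).eventuallyEq_nhdsNE_iff_eventuallyEq_nhds (hG (mem_univ z))).1
    hFG).eq_of_nhds

theorem toMeromorphicNFOn_eventuallyEq {𝕜 E : Type*} [NontriviallyNormedField 𝕜]
    [NormedAddCommGroup E] [NormedSpace 𝕜 E] {F : 𝕜 → E} {U : Set 𝕜} (hF : MeromorphicOn F U)
    {z : 𝕜} (hz : z ∈ U) (han : AnalyticAt 𝕜 F z) : toMeromorphicNFOn F U =ᶠ[𝓝 z] F := by
  have h := toMeromorphicNFOn_eq_toMeromorphicNFAt_on_nhds hF hz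
  rwa [toMeromorphicNFAt_eq_self.2 han.meromorphicNFAt] at h

theorem IsIntertwiningContinuation.eq {ν : ℂ} {f : Mp → ℂ} {g : Mp} {F G : ℂ → ℂ}
    (hF : IsIntertwiningContinuation ν f g F) (hG : IsIntertwiningContinuation ν f g G) :
    F = G := by
  have hone : {μ : ℂ | 0 < μ.re} ∈ 𝓝 (1 : ℂ) :=
    (isOpen_lt continuous_const Complex.continuous_re).mem_nhds (by simp)
  refine eq_of_meromorphicNFOn_univ hF.1 hG.1 (z₀ := 1) ?_
  filter_upwards [nhdsWithin_le_nhds hone] with μ hμ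
  rw [(hF.2 μ hμ).2, (hG.2 μ hμ).2]

theorem IsIntertwiningContinuation.intertwining_eq {ν : ℂ} {f : Mp → ℂ} {g : Mp} {F : ℂ → ℂ}
    (hF : IsIntertwiningContinuation ν f g F) : intertwining ν f g = F ν := by
  have h : ∃ F : ℂ → ℂ, IsIntertwiningContinuation ν f g F := ⟨F, hF⟩
  rw [intertwining, dif_pos h, h.choose_spec.eq hF]

theorem analyticAt_Gamma {μ : ℂ} (hμ : ∀ n : ℕ, μ ≠ -(n : ℂ)) :
    AnalyticAt ℂ Complex.Gamma μ := by
  simpa only [Pi.inv_def, inv_inv] using (Complex.differentiable_one_div_Gamma.analyticAt μ).inv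
    (inv_ne_zero (Complex.Gamma_ne_zero hμ))

/-- If `b` are the Fourier coefficients of `h` with respect to the characters of `K̃`, the integral
`∫ cos(arctan y)^{μ+1} h(φ - arctan y) dy` divided by `Γ(μ)`, which is entire in `μ`. -/
def intertwiningSeries (ε : ℤˣ) (b : ℤ → ℂ) (φ : ℝ) (μ : ℂ) : ℂ :=
  ∑' n, b n * kCharacter ε n φ * cauchyEntire μ (kExponent ε n)

theorem differentiable_intertwiningSeries (ε : ℤˣ) {b : ℤ → ℂ} (hb : RapidDecay b) (φ : ℝ) :
    Differentiable ℂ (intertwiningSeries ε b φ) := by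
  intro μ
  obtain ⟨R, hR⟩ := exists_gt ‖μ‖
  obtain ⟨k, hk⟩ := exists_nat_ge (1 + R)
  obtain ⟨C, hC0, hC⟩ := exists_norm_cauchyEntire_kExponent_le ε k R
  obtain ⟨D, -, hD⟩ := hb.exists_norm_mul_pow_le k
  refine (Complex.differentiableOn_tsum_of_summable_norm (U := Metric.ball 0 R)
    ((summable_inv_one_add_int_sq.mul_left D).mul_left C)
    (fun n => ((differentiable_cauchyEntire _).const_mul _).differentiableOn) Metric.isOpen_ball
    fun n w hw => ?_).differentiableAt (Metric.isOpen_ball.mem_nhds (mem_ball_zero_iff.2 hR))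
  have hwR : ‖w‖ < R := mem_ball_zero_iff.1 hw
  have hre : 1 - 2 * (k : ℝ) ≤ w.re := by
    linarith [(abs_le.1 (Complex.abs_re_le_norm w)).1, norm_nonneg w]
  rw [norm_mul, norm_mul, norm_kCharacter, mul_one]
  calc ‖b n‖ * ‖cauchyEntire w (kExponent ε n)‖
      ≤ ‖b n‖ * (C * (1 + (n : ℝ) ^ 2) ^ k) := by gcongr; exact hC w hwR.le hre n
    _ = C * (‖b n‖ * (1 + (n : ℝ) ^ 2) ^ k) := by ring
    _ ≤ _ := mul_le_mul_of_nonneg_left (hD n) hC0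

theorem transport_kan_mul {ε : ℤˣ} {ν : ℂ} {f : Mp → ℂ} (hf : f ∈ principalSeries ε (-ν))
    (μ : ℂ) (θ u x t : ℝ) (hu : 0 < u) :
    transport ν μ f (kTilde θ * aTilde u hu * nMinusTilde x * sTilde * nTilde t) =
      (u : ℂ) ^ (-(μ + 1)) * ((Real.cos (Real.arctan ((t - x) / u ^ 2)) : ℂ) ^ (μ + 1) *
        f (kTilde (θ + Real.pi / 2 - Real.arctan ((t - x) / u ^ 2)))) := by
  obtain ⟨z, hz⟩ := kan_mul_sTilde_mul_nTilde θ u x t hu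
  rw [hz, transport, principalSeries_apply_kan hf, iwasawaA_kan, ← one_div, ← Real.cos_arctan]
  set c := Real.cos (Real.arctan ((t - x) / u ^ 2))
  have hc : 0 < c := Real.cos_arctan_pos _
  have hcu : ((c * u⁻¹ : ℝ) : ℂ) ≠ 0 := by exact_mod_cast (mul_pos hc (inv_pos.2 hu)).ne'
  have hpow : ((c * u⁻¹ : ℝ) : ℂ) ^ (1 - -ν) * ((c * u⁻¹ : ℝ) : ℂ) ^ (μ - ν) =
      (u : ℂ) ^ (-(μ + 1)) * (c : ℂ) ^ (μ + 1) := by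
    rw [← Complex.cpow_add _ _ hcu, show 1 - -ν + (μ - ν) = μ + 1 by ring, Complex.ofReal_mul,
      Complex.mul_cpow_ofReal_nonneg hc.le (inv_pos.2 hu).le, Complex.ofReal_inv,
      Complex.inv_cpow _ _ (by rw [Complex.arg_ofReal_of_nonneg hu.le]; exact Real.pi_pos.ne),
      Complex.cpow_neg, mul_comm]
  rw [mul_right_comm, hpow, mul_assoc]

theorem norm_cos_arctan_cpow (z : ℂ) (y : ℝ) :
    ‖(Real.cos (Real.arctan y) : ℂ) ^ z‖ = Real.cos (Real.arctan y) ^ z.re :=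
  Complex.norm_cpow_eq_rpow_re_of_pos (Real.cos_arctan_pos y) z

theorem integrable_cos_arctan_cpow {z : ℂ} (hz : 1 < z.re) :
    Integrable fun y : ℝ => (Real.cos (Real.arctan y) : ℂ) ^ z := by
  have hcont : Continuous fun y : ℝ => (Real.cos (Real.arctan y) : ℂ) ^ z :=
    (Complex.continuous_ofReal.comp (Real.continuous_cos.comp Real.continuous_arctan)).cpow
      continuous_const fun y => Or.inl (Real.cos_arctan_pos y)
  exact (integrable_cos_arctan_rpow hz).mono' hcont.aestronglyMeasurable
    (Eventually.of_forall fun y => (norm_cos_arctan_cpow z y).le)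

theorem integrable_cos_arctan_cpow_mul {h : ℝ → ℂ} (hh : Continuous h) {T : ℝ}
    (hper : Function.Periodic h T) (hT : T ≠ 0) {z : ℂ} (hz : 1 < z.re) (φ : ℝ) :
    Integrable fun y => (Real.cos (Real.arctan y) : ℂ) ^ z * h (φ - Real.arctan y) := by
  obtain ⟨C, hC⟩ := (hper.isBounded_of_continuous hT hh).exists_norm_le
  exact (integrable_cos_arctan_cpow hz).mul_bdd
    (hh.comp (continuous_const.sub Real.continuous_arctan)).aestronglyMeasurable
    (Eventually.of_forall fun y => hC _ (mem_range_self _))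

theorem integral_cos_arctan_cpow_mul_kCharacter (ε : ℤˣ) (n : ℤ) {μ : ℂ} (hμ : 0 < μ.re) (φ : ℝ) :
    ∫ y, (Real.cos (Real.arctan y) : ℂ) ^ (μ + 1) * kCharacter ε n (φ - Real.arctan y) =
      Complex.Gamma μ * (kCharacter ε n φ * cauchyEntire μ (kExponent ε n)) := by
  rw [mul_left_comm, ← cauchyIntegral_half_add_half_sub hμ, cauchyIntegral, ← integral_const_mul]
  refine integral_congr_ae (Eventually.of_forall fun y => ?_)
  simp only [cauchyKernel_half_add_half_sub, sub_eq_add_neg φ, kCharacter_add]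
  rw [mul_left_comm]
  rfl

theorem integral_cos_arctan_cpow_mul {ε : ℤˣ} {h : ℝ → ℂ} {b : ℤ → ℂ}
    (hb : Summable fun n => ‖b n‖) (hs : ∀ θ, HasSum (fun n => b n * kCharacter ε n θ) (h θ))
    {μ : ℂ} (hμ : 0 < μ.re) (φ : ℝ) :
    ∫ y, (Real.cos (Real.arctan y) : ℂ) ^ (μ + 1) * h (φ - Real.arctan y) =
      Complex.Gamma μ * intertwiningSeries ε b φ μ := by
  have hz : 1 < (μ + 1).re := by simpa using hμ
  have hint (n : ℤ) : Integrable fun y => b n *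
      ((Real.cos (Real.arctan y) : ℂ) ^ (μ + 1) * kCharacter ε n (φ - Real.arctan y)) :=
    (integrable_cos_arctan_cpow_mul (contDiff_kCharacter ε n).continuous
      (isKEquivariant_kCharacter ε n).periodic (by positivity) hz φ).const_mul _
  have hsum := hasSum_integral_of_summable_integral_norm hint (by
    simp_rw [norm_mul, norm_kCharacter, mul_one, norm_cos_arctan_cpow, integral_const_mul]
    exact hb.mul_right _)
  have hterm (y : ℝ) : ∑' n, b n * ((Real.cos (Real.arctan y) : ℂ) ^ (μ + 1) *
      kCharacter ε n (φ - Real.arctan y)) =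
        (Real.cos (Real.arctan y) : ℂ) ^ (μ + 1) * h (φ - Real.arctan y) := by
    rw [← (hs _).tsum_eq, ← tsum_mul_left]
    exact tsum_congr fun n => mul_left_comm _ _ _
  simp_rw [hterm, integral_const_mul, integral_cos_arctan_cpow_mul_kCharacter ε _ hμ] at hsum
  rw [← hsum.tsum_eq, intertwiningSeries, ← tsum_mul_left]
  exact tsum_congr fun n => by ring

theorem integral_comp_sub_div {E : Type*} [NormedAddCommGroup E] [NormedSpace ℝ E] (G : ℝ → E)
    (x : ℝ) {c : ℝ} (hc : 0 < c) : ∫ t, G ((t - x) / c) = c • ∫ t, G t := by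
  rw [integral_sub_right_eq_self (fun t => G (t / c)), Measure.integral_comp_div, abs_of_pos hc]

section Continuation

variable {ε : ℤˣ} {ν : ℂ} {f : Mp → ℂ} (hf : f ∈ principalSeries ε (-ν))
  {b : ℤ → ℂ} (hb : RapidDecay b)
  (hs : ∀ θ, HasSum (fun n => b n * kCharacter ε n θ) (f (kTilde θ)))

/-- The value at `k̃_θ ã_u ñ₋`, where `φ = θ + π / 2`, of the intertwining integral with parameter
`μ`, as an explicit meromorphic function of `μ`. -/
def continuedIntegral (ε : ℤˣ) (b : ℤ → ℂ) (u φ : ℝ) (μ : ℂ) : ℂ :=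
  (u : ℂ) ^ (1 - μ) * (Complex.Gamma μ * intertwiningSeries ε b φ μ)

include hf in
theorem integrable_transport {μ : ℂ} (hμ : 0 < μ.re) (θ u x : ℝ) (hu : 0 < u) :
    Integrable fun t =>
      transport ν μ f (kTilde θ * aTilde u hu * nMinusTilde x * sTilde * nTilde t) := by
  simp_rw [transport_kan_mul hf]
  have hint := integrable_cos_arctan_cpow_mul (principalSeries_contDiff hf).continuous
    (principalSeries_isKEquivariant hf).periodic (by positivity) (z := μ + 1) (by simpa using hμ)
    (θ + Real.pi / 2)
  exact ((hint.comp_div (pow_pos hu 2).ne').comp_sub_right x).const_mul _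

include hf hb hs in
theorem integral_transport {μ : ℂ} (hμ : 0 < μ.re) (θ u x : ℝ) (hu : 0 < u) :
    ∫ t, transport ν μ f (kTilde θ * aTilde u hu * nMinusTilde x * sTilde * nTilde t) =
      continuedIntegral ε b u (θ + Real.pi / 2) μ := by
  have hu0 : (u : ℂ) ≠ 0 := by exact_mod_cast hu.ne'
  simp_rw [transport_kan_mul hf]
  rw [integral_const_mul, integral_comp_sub_div (fun y : ℝ =>
      (Real.cos (Real.arctan y) : ℂ) ^ (μ + 1) * f (kTilde (θ + Real.pi / 2 - Real.arctan y)))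
      x (pow_pos hu 2), integral_cos_arctan_cpow_mul hb.summable_norm hs hμ, continuedIntegral,
    Complex.real_smul, ← mul_assoc, show 1 - μ = -(μ + 1) + (2 : ℕ) by push_cast; ring,
    Complex.cpow_add _ _ hu0, Complex.cpow_natCast, Complex.ofReal_pow]

include hb in
theorem differentiable_cpow_mul_intertwiningSeries {u : ℝ} (hu : 0 < u) (φ : ℝ) :
    Differentiable ℂ fun μ => (u : ℂ) ^ (1 - μ) * intertwiningSeries ε b φ μ :=
  (((differentiable_const 1).sub differentiable_id).const_cpow
    (Or.inl (by exact_mod_cast hu.ne'))).mul (differentiable_intertwiningSeries ε hb φ)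

theorem continuedIntegral_eq (u φ : ℝ) : continuedIntegral ε b u φ =
    Complex.Gamma * fun μ => (u : ℂ) ^ (1 - μ) * intertwiningSeries ε b φ μ :=
  funext fun _ => mul_left_comm _ _ _

include hb in
theorem meromorphic_continuedIntegral {u : ℝ} (hu : 0 < u) (φ : ℝ) :
    Meromorphic (continuedIntegral ε b u φ) := fun μ => by
  rw [continuedIntegral_eq]
  exact (Meromorphic.Gamma μ).mul
    ((differentiable_cpow_mul_intertwiningSeries hb hu φ).analyticAt μ).meromorphicAt

include hb in
theorem analyticAt_continuedIntegral {u : ℝ} (hu : 0 < u) (φ : ℝ) {μ : ℂ}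
    (hμ : ∀ n : ℕ, μ ≠ -(n : ℂ)) : AnalyticAt ℂ (continuedIntegral ε b u φ) μ := by
  rw [continuedIntegral_eq]
  exact (analyticAt_Gamma hμ).mul
    ((differentiable_cpow_mul_intertwiningSeries hb hu φ).analyticAt μ)

include hf hb hs in
theorem exists_isIntertwiningContinuation (θ u x : ℝ) (hu : 0 < u) :
    ∃ F : ℂ → ℂ, IsIntertwiningContinuation ν f (kTilde θ * aTilde u hu * nMinusTilde x) F ∧
      ∀ μ : ℂ, (∀ n : ℕ, μ ≠ -(n : ℂ)) → AnalyticAt ℂ F μ ∧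
        F μ = continuedIntegral ε b u (θ + Real.pi / 2) μ := by
  set F := continuedIntegral ε b u (θ + Real.pi / 2)
  have heq {μ : ℂ} (hμ : ∀ n : ℕ, μ ≠ -(n : ℂ)) : toMeromorphicNFOn F univ =ᶠ[𝓝 μ] F :=
    toMeromorphicNFOn_eventuallyEq (fun μ _ => meromorphic_continuedIntegral hb hu _ μ)
      (mem_univ μ) (analyticAt_continuedIntegral hb hu _ hμ)
  refine ⟨toMeromorphicNFOn F univ, ⟨meromorphicNFOn_toMeromorphicNFOn F univ, fun μ hμ =>
    ⟨integrable_transport hf hμ θ u x hu, ?_⟩⟩, fun μ hμ =>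
    ⟨(analyticAt_continuedIntegral hb hu _ hμ).congr (heq hμ).symm, (heq hμ).eq_of_nhds⟩⟩
  have hpole (n : ℕ) : μ ≠ -(n : ℂ) := by
    rintro rfl
    exact hμ.not_ge (by simp)
  rw [(heq hpole).eq_of_nhds, integral_transport hf hb hs hμ]

end Continuation

/-! ### Action on Fourier coefficients -/

/-- The scalar by which the intertwining operator acts on the `n`-th `K̃`-type. -/
def intertwiningScalar (ε : ℤˣ) (ν : ℂ) (n : ℤ) : ℂ :=
  kCharacter ε n (Real.pi / 2) * (Complex.Gamma ν * cauchyEntire ν (kExponent ε n))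

theorem RapidDecay.mul_intertwiningScalar {b : ℤ → ℂ} (hb : RapidDecay b) (ε : ℤˣ) (ν : ℂ) :
    RapidDecay fun n => b n * intertwiningScalar ε ν n := by
  obtain ⟨k, hk⟩ := exists_nat_ge (1 - ν.re)
  obtain ⟨C, -, hC⟩ := exists_norm_cauchyEntire_kExponent_le ε k ‖ν‖
  refine hb.mul (C := ‖Complex.Gamma ν‖ * C) (k := k) fun n => ?_
  rw [intertwiningScalar, norm_mul, norm_mul, norm_kCharacter, one_mul, mul_assoc]
  exact mul_le_mul_of_nonneg_left (hC ν le_rfl (by linarith [k.cast_nonneg (α := ℝ)]) n)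
    (norm_nonneg _)

theorem continuedIntegral_add_pi_div_two (ε : ℤˣ) (b : ℤ → ℂ) (ν : ℂ) (u θ : ℝ) :
    continuedIntegral ε b u (θ + Real.pi / 2) ν =
      (u : ℂ) ^ (1 - ν) * ∑' n, b n * intertwiningScalar ε ν n * kCharacter ε n θ := by
  rw [continuedIntegral, intertwiningSeries, ← tsum_mul_left]
  congr 1
  refine tsum_congr fun n => ?_
  rw [kCharacter_add, intertwiningScalar]
  ring

theorem isKEquivariant_tsum_mul_kCharacter (ε : ℤˣ) (b : ℤ → ℂ) :
    IsKEquivariant ε fun θ => ∑' n, b n * kCharacter ε n θ := fun θ => by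
  simp only [isKEquivariant_kCharacter ε _ θ, mul_left_comm (b _), tsum_mul_left]

section

variable {ε : ℤˣ} {ν : ℂ} (hν : ∀ n : ℕ, ν ≠ -(n : ℂ)) {f : Mp → ℂ}
  (hf : f ∈ principalSeries ε (-ν)) {b : ℤ → ℂ} (hb : RapidDecay b)
  (hs : ∀ θ, HasSum (fun n => b n * kCharacter ε n θ) (f (kTilde θ)))

include hν hf

theorem intertwiningDefinedAt_of_mem_principalSeries : IntertwiningDefinedAt ν f := fun g => by
  obtain ⟨θ, u, x, hu, rfl⟩ := exists_kan g
  obtain ⟨b, hb, hs⟩ :=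
    (principalSeries_isKEquivariant hf).exists_rapidDecay_hasSum (principalSeries_contDiff hf)
  obtain ⟨F, hF, hFν⟩ := exists_isIntertwiningContinuation hf hb hs θ u x hu
  exact ⟨F, hF, (hFν ν hν).1⟩

include hb hs

theorem intertwining_eq_kExtend : intertwining ν f =
    kExtend ν fun θ => ∑' n, b n * intertwiningScalar ε ν n * kCharacter ε n θ := by
  ext g
  obtain ⟨θ, u, x, hu, rfl⟩ := exists_kan g
  obtain ⟨F, hF, hFν⟩ := exists_isIntertwiningContinuation hf hb hs θ u x hu
  rw [hF.intertwining_eq, (hFν ν hν).2, continuedIntegral_add_pi_div_two,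
    kExtend_kan (isKEquivariant_tsum_mul_kCharacter ε _).periodic]

theorem intertwining_mem_principalSeries : intertwining ν f ∈ principalSeries ε ν := by
  rw [intertwining_eq_kExtend hν hf hb hs]
  exact kExtend_mem ((hb.mul_intertwiningScalar ε ν).contDiff_tsum ε)
    (isKEquivariant_tsum_mul_kCharacter ε _) ν

theorem hasSum_intertwining_kTilde (θ : ℝ) :
    HasSum (fun n => b n * intertwiningScalar ε ν n * kCharacter ε n θ)
      (intertwining ν f (kTilde θ)) := by
  rw [intertwining_eq_kExtend hν hf hb hs,
    kExtend_kTilde (isKEquivariant_tsum_mul_kCharacter ε _).periodic]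
  refine (Summable.of_norm ?_).hasSum
  simpa only [norm_mul, norm_kCharacter, mul_one] using
    (hb.mul_intertwiningScalar ε ν).summable_norm

end

/-! ### Evaluation of the scalars -/

theorem Gamma_mul_Gamma_neg (ν : ℂ) : Complex.Gamma ν * Complex.Gamma (-ν) =
    -(Real.pi / (ν * Complex.sin (Real.pi * ν))) := by
  rcases eq_or_ne ν 0 with rfl | hν
  · simp
  · rw [mul_comm ν, ← div_div, ← Complex.Gamma_mul_Gamma_one_sub, sub_eq_neg_add,
      Complex.Gamma_add_one _ (neg_ne_zero.2 hν)]
    field_simp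

theorem inv_Gamma_half_one_add_mul_inv_Gamma_half_one_sub (w : ℂ) :
    (Complex.Gamma ((1 + w) / 2))⁻¹ * (Complex.Gamma ((1 - w) / 2))⁻¹ =
      Complex.cos (Real.pi * w / 2) / Real.pi := by
  rw [← mul_inv, show (1 - w) / 2 = 1 - (1 + w) / 2 by ring, Complex.Gamma_mul_Gamma_one_sub,
    inv_div, show Real.pi * ((1 + w) / 2) = Real.pi * w / 2 + Real.pi / 2 by ring,
    Complex.sin_add_pi_div_two]

theorem cauchyEntire_mul_cauchyEntire_neg (ν : ℂ) (l : ℝ) :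
    cauchyEntire ν l * cauchyEntire (-ν) l =
      2 * (Complex.cos (Real.pi * ν) + Complex.cos (Real.pi * l)) := by
  have hpi : (Real.pi : ℂ) ≠ 0 := by exact_mod_cast Real.pi_ne_zero
  have hadd := inv_Gamma_half_one_add_mul_inv_Gamma_half_one_sub (ν + l)
  have hsub := inv_Gamma_half_one_add_mul_inv_Gamma_half_one_sub (ν - l)
  have htwo : (2 : ℂ) ^ (1 - ν) * 2 ^ (1 - -ν) = 4 := by
    rw [← Complex.cpow_add _ _ two_ne_zero, show 1 - ν + (1 - -ν) = (2 : ℕ) by push_cast; ring,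
      Complex.cpow_natCast]
    norm_num
  rw [Complex.cos_add_cos, ← mul_add, ← mul_sub]
  calc _ = (Real.pi : ℂ) ^ 2 * (2 ^ (1 - ν) * 2 ^ (1 - -ν)) *
        ((Complex.Gamma ((1 + (ν + l)) / 2))⁻¹ * (Complex.Gamma ((1 - (ν + l)) / 2))⁻¹) *
        ((Complex.Gamma ((1 + (ν - l)) / 2))⁻¹ * (Complex.Gamma ((1 - (ν - l)) / 2))⁻¹) := by
        unfold cauchyEntire; ring_nf
    _ = _ := by rw [hadd, hsub, htwo]; field_simp; ring

theorem cos_pi_mul_kExponent (ε : ℤˣ) (n : ℤ) : Complex.cos (Real.pi * kExponent ε n) = 0 := by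
  have h := congrArg Complex.re (kCharacter_pi ε n)
  rw [kCharacter, Complex.exp_ofReal_mul_I_re, ← Complex.ofReal_intCast, Complex.neg_re,
    Complex.re_ofReal_mul, Complex.I_re, mul_zero, neg_zero] at h
  rw [← Complex.ofReal_mul, ← Complex.ofReal_cos, mul_comm, h, Complex.ofReal_zero]

theorem intertwiningScalar_mul_intertwiningScalar_neg (ε : ℤˣ) (ν : ℂ) (n : ℤ) :
    intertwiningScalar ε ν n * intertwiningScalar ε (-ν) n =
      2 * Real.pi * ((ε : ℤ) : ℂ) * Complex.I * Complex.cot (Real.pi * ν) / ν := by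
  have hχ : kCharacter ε n (Real.pi / 2) * kCharacter ε n (Real.pi / 2) =
      -(((ε : ℤ) : ℂ) * Complex.I) := by
    rw [← kCharacter_add, add_halves, kCharacter_pi]
  calc _ = kCharacter ε n (Real.pi / 2) * kCharacter ε n (Real.pi / 2) *
        (Complex.Gamma ν * Complex.Gamma (-ν)) *
        (cauchyEntire ν (kExponent ε n) * cauchyEntire (-ν) (kExponent ε n)) := by
        unfold intertwiningScalar; ring
    _ = _ := by
        rw [hχ, Gamma_mul_Gamma_neg, cauchyEntire_mul_cauchyEntire_neg, cos_pi_mul_kExponent,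
          add_zero, Complex.cot]
        ring

theorem exp_neg_units_mul_pi_div_four_mul_I (ε : ℤˣ) :
    Complex.exp ((-(((ε : ℤ) : ℝ) * (Real.pi / 4)) : ℝ) * Complex.I) =
      (1 - ((ε : ℤ) : ℂ) * Complex.I) / (√2 : ℝ) := by
  have hsqrt : ((√2 / 2 : ℝ) : ℂ) = 1 / (√2 : ℝ) := by
    rw [← Complex.ofReal_one, ← Complex.ofReal_div, Real.sqrt_div_self']
  rw [Complex.exp_mul_I, ← Complex.ofReal_cos, ← Complex.ofReal_sin, Real.cos_neg, Real.sin_neg]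
  rcases Int.units_eq_one_or ε with rfl | rfl
  · simp only [Units.val_one, Int.cast_one, one_mul, Real.cos_pi_div_four, Real.sin_pi_div_four,
      Complex.ofReal_neg, hsqrt]
    ring
  · simp only [Units.val_neg, Units.val_one, Int.cast_neg, Int.cast_one, neg_mul, one_mul,
      Real.cos_neg, Real.sin_neg, Real.cos_pi_div_four, Real.sin_pi_div_four, neg_neg, hsqrt]
    ring

theorem kCharacter_pi_div_two (ε : ℤˣ) (n : ℤ) : kCharacter ε n (Real.pi / 2) =
    (-1) ^ n * ((1 - ((ε : ℤ) : ℂ) * Complex.I) / (√2 : ℝ)) := by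
  rw [← exp_neg_units_mul_pi_div_four_mul_I, ← Complex.exp_pi_mul_I, ← Complex.exp_int_mul,
    ← Complex.exp_add, kCharacter, kExponent]
  congr 1
  push_cast
  ring

theorem cauchyEntire_kExponent_neg_mul (ε : ℤˣ) (ν : ℂ) (j : ℤ) :
    cauchyEntire ν (kExponent ε (-ε * j)) = cauchyEntire ν (2 * j + 1 / 2) := by
  rcases Int.units_eq_one_or ε with rfl | rfl
  · rw [← cauchyEntire_neg, kExponent]
    congr 1
    push_cast
    ring
  · rw [kExponent]
    congr 1
    push_cast
    ring

theorem intertwiningScalar_neg_mul (ε : ℤˣ) (ν : ℂ) (j : ℤ) :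
    intertwiningScalar ε ν (-ε * j) =
      Complex.I ^ (-(ε : ℤ) * (j + j)) * ((1 - ((ε : ℤ) : ℂ) * Complex.I) / (Real.sqrt 2 : ℂ)) *
        ((Real.pi : ℂ) * 2 ^ (1 - ν) * Complex.Gamma ν /
          (Complex.Gamma (-(1 / 2) * (((j + j : ℤ) : ℂ) + 1 / 2) + (ν + 1) / 2) *
            Complex.Gamma ((1 / 2) * (((j + j : ℤ) : ℂ) + 1 / 2) + (ν + 1) / 2))) := by
  rw [intertwiningScalar, cauchyEntire_kExponent_neg_mul, kCharacter_pi_div_two, mul_add,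
    zpow_add₀ Complex.I_ne_zero, ← mul_zpow, Complex.I_mul_I, cauchyEntire,
    show -(1 / 2) * (((j + j : ℤ) : ℂ) + 1 / 2) + (ν + 1) / 2 =
      (1 + ν - ((2 * j + 1 / 2 : ℝ) : ℂ)) / 2 by push_cast; ring,
    show (1 / 2) * (((j + j : ℤ) : ℂ) + 1 / 2) + (ν + 1) / 2 =
      (1 + ν + ((2 * j + 1 / 2 : ℝ) : ℂ)) / 2 by push_cast; ring, div_eq_mul_inv _ (_ * _), mul_inv]
  ring

theorem intertwining_comp {ε : ℤˣ} {ν : ℂ} (hν : ∀ n : ℤ, ν ≠ (n : ℂ)) {f : Mp → ℂ}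
    (hf : f ∈ principalSeries ε (-ν)) :
    IntertwiningDefinedAt ν f ∧ intertwining ν f ∈ principalSeries ε ν ∧
      IntertwiningDefinedAt (-ν) (intertwining ν f) ∧
      intertwining (-ν) (intertwining ν f) =
        (2 * (Real.pi : ℂ) * ((ε : ℤ) : ℂ) * Complex.I * Complex.cot (Real.pi * ν) / ν) • f := by
  obtain ⟨b, hb, hs⟩ :=
    (principalSeries_isKEquivariant hf).exists_rapidDecay_hasSum (principalSeries_contDiff hf)
  have hpole : ∀ n : ℕ, ν ≠ -(n : ℂ) := fun n => by simpa using hν (-n)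
  have hpole' : ∀ n : ℕ, -ν ≠ -(n : ℂ) := fun n h => hν n (by simpa using neg_injective h)
  have hmem := intertwining_mem_principalSeries hpole hf hb hs
  have hmem' : intertwining ν f ∈ principalSeries ε (- -ν) := by rwa [neg_neg]
  have hb' := hb.mul_intertwiningScalar ε ν
  have hs' := hasSum_intertwining_kTilde hpole hf hb hs
  refine ⟨intertwiningDefinedAt_of_mem_principalSeries hpole hf, hmem,
    intertwiningDefinedAt_of_mem_principalSeries hpole' hmem',
    eq_of_eqOn_kTilde (intertwining_mem_principalSeries hpole' hmem' hb' hs')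
      (Submodule.smul_mem _ _ hf) fun θ =>
        (hasSum_intertwining_kTilde hpole' hmem' hb' hs' θ).unique ?_⟩
  simp only [mul_assoc (b _), intertwiningScalar_mul_intertwiningScalar_neg, mul_left_comm (b _)]
  exact (hs θ).mul_left _

theorem hasSum_pi_single_mul {ι R : Type*} [DecidableEq ι] [NonAssocSemiring R]
    [TopologicalSpace R] (i : ι) (a : ι → R) :
    HasSum (fun j => (Pi.single i 1 : ι → R) j * a j) (a i) := by
  simpa using hasSum_single (f := fun j => (Pi.single i 1 : ι → R) j * a j) i fun j hj => by
    rw [Pi.single_eq_of_ne hj, zero_mul]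

theorem intertwining_isKVector {ε : ℤˣ} {ν : ℂ} {ℓ : ℤ} (hℓ : Even ℓ) (hν : ∀ n : ℕ, ν ≠ -(n : ℂ))
    {φ φ' : Mp → ℂ} (hφ : IsKVector ε (-ν) ℓ φ) (hφ' : IsKVector ε ν ℓ φ') :
    IntertwiningDefinedAt ν φ ∧ intertwining ν φ =
      (Complex.I ^ (-(ε : ℤ) * ℓ) * ((1 - ((ε : ℤ) : ℂ) * Complex.I) / (Real.sqrt 2 : ℂ)) *
        ((Real.pi : ℂ) * 2 ^ (1 - ν) * Complex.Gamma ν /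
          (Complex.Gamma (-(1 / 2) * ((ℓ : ℂ) + 1 / 2) + (ν + 1) / 2) *
            Complex.Gamma ((1 / 2) * ((ℓ : ℂ) + 1 / 2) + (ν + 1) / 2)))) • φ' := by
  obtain ⟨j, rfl⟩ := hℓ
  obtain ⟨hmem, hval⟩ := isKVector_add_self_iff.1 hφ
  obtain ⟨hmem', hval'⟩ := isKVector_add_self_iff.1 hφ'
  have hb := rapidDecay_single (-ε * j) 1
  have hs (θ : ℝ) := hasSum_pi_single_mul (-ε * j) fun n => kCharacter ε n θ
  simp only [← hval] at hs
  refine ⟨intertwiningDefinedAt_of_mem_principalSeries hν hmem,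
    eq_of_eqOn_kTilde (intertwining_mem_principalSeries hν hmem hb hs)
      (Submodule.smul_mem _ _ hmem') fun θ =>
        (hasSum_intertwining_kTilde hν hmem hb hs θ).unique ?_⟩
  simp only [mul_assoc (Pi.single _ _ _)]
  rw [← intertwiningScalar_neg_mul, Pi.smul_apply, hval', smul_eq_mul]
  exact hasSum_pi_single_mul _ _

end Metaplectic

end

theorem mainTheorem8 (ε : ℤˣ) :
    -- existence and uniqueness of `φ_{ε,ν,ℓ}`
    (∀ (ν : ℂ) (ℓ : ℤ), Even ℓ → ∃! φ : Metaplectic.Mp → ℂ, Metaplectic.IsKVector ε ν ℓ φ) ∧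
    -- the action of `I_{ε,ν}` on `φ_{ε,-ν,ℓ}`
    (∀ (ν : ℂ) (ℓ : ℤ), Even ℓ → (∀ n : ℕ, ν ≠ -(n : ℂ)) →
      ∀ φ φ' : Metaplectic.Mp → ℂ,
        Metaplectic.IsKVector ε (-ν) ℓ φ → Metaplectic.IsKVector ε ν ℓ φ' →
          Metaplectic.IntertwiningDefinedAt ν φ ∧
          Metaplectic.intertwining ν φ =
            (Complex.I ^ (-(ε : ℤ) * ℓ) * ((1 - ((ε : ℤ) : ℂ) * Complex.I) / (Real.sqrt 2 : ℂ)) *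
              ((Real.pi : ℂ) * 2 ^ (1 - ν) * Complex.Gamma ν /
                (Complex.Gamma (-(1 / 2) * ((ℓ : ℂ) + 1 / 2) + (ν + 1) / 2) *
                  Complex.Gamma ((1 / 2) * ((ℓ : ℂ) + 1 / 2) + (ν + 1) / 2)))) • φ') ∧
    -- the composition `I_{ε,-ν} I_{ε,ν}`
    (∀ ν : ℂ, (∀ n : ℤ, ν ≠ (n : ℂ)) → ∀ f ∈ Metaplectic.principalSeries ε (-ν),
      Metaplectic.IntertwiningDefinedAt ν f ∧
      Metaplectic.intertwining ν f ∈ Metaplectic.principalSeries ε ν ∧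
      Metaplectic.IntertwiningDefinedAt (-ν) (Metaplectic.intertwining ν f) ∧
      Metaplectic.intertwining (-ν) (Metaplectic.intertwining ν f) =
        (2 * (Real.pi : ℂ) * ((ε : ℤ) : ℂ) * Complex.I * Complex.cot ((Real.pi : ℂ) * ν) / ν) • f) :=
  ⟨fun ν ℓ hℓ => Metaplectic.existsUnique_isKVector ε ν ℓ hℓ,
    fun _ _ hℓ hν _ _ hφ hφ' => Metaplectic.intertwining_isKVector hℓ hν hφ hφ',
    fun _ hν _ hf => Metaplectic.intertwining_comp hν hf⟩
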